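/- Let $k$ be a field of characteristic $\neq 2$, let $m,n,d\ge 0$, and let $M=k^{m|n}$ be the superspace with basis $Z_1,\dots,Z_{m+n}$, where $Z_a$ is even for $a\le m$ and odd for $a>m$; $\Pi M$ is $M$ with reversed parity. For a superspace with homogeneous basis $(Z_a)$ and a word $\boldsymbol i=(i_1,\dots,i_d)$ put $Z^{\boldsymbol i}=Z_{i_1}\otimes\dots\otimes Z_{i_d}$, and let $\mathfrak S_d$ act on the $d$-th tensor power from the right by $$Z^{\boldsymbol i}.\sigma=\Big(\prod_{s<t,\ \sigma^{-1}s>\sigma^{-1}t}(-1)^{|Z_{i_s}||Z_{i_t}|}\Big)Z^{\boldsymbol i.\sigma},\qquad (\boldsymbol i.\sigma)_r=i_{\sigma r}.$$ **The algebra.** Let $S(m|n,d)=\operatorname{End}_{k\mathfrak S_d}(M^{\otimes d})$ be the Schur superalgebra. Let $E_{a,b}$ be the matrix units of $\operatorname{End}(M)$. A pair of words $(\boldsymbol i,\boldsymbol j)$ is strict if $(i_a,j_a)\ne(i_b,j_b)$ whenever $a\neq b$ and $E_{i_a,j_a},E_{i_b,j_b}$ are odd. For a strict pair let $$E^{(\boldsymbol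 i,\boldsymbol j)}=\sum_{(\boldsymbol s,\boldsymbol t)}\pm\,E_{s_1,t_1}\otimes\dots\otimes E_{s_d,t_d}\in S(m|n,d),$$ the sum over the distinct pairs $(\boldsymbol s,\boldsymbol t)=(\boldsymbol i.\tau,\boldsymbol j.\tau)$, $\tau\in\mathfrak S_d$, with sign $\prod_{a<b,\ \tau^{-1}a>\tau^{-1}b}(-1)^{|E_{i_a,j_a}||E_{i_b,j_b}|}$, where tensors of endomorphisms act on $M^{\otimes d}$ by the rule of signs. Let $N(m|n,d)\subset S(m|n,d)$ be the linear span of the $E^{(\boldsymbol i,\boldsymbol j)}$ over the strict pairs such that $\boldsymbol i.\sigma\prec\boldsymbol j.\sigma$ in the lexicographic order for all $\sigma\in\mathfrak S_d$; equivalently, $i_r\le j_r$ for all $r$ and $\boldsymbol i\ne\boldsymbol j$. **The module.** Let $\lambda$ be a partition of $d$, with conjugate $\lambda'$, and let $l(\lambda')$ be the number of nonzero parts of $\lambda'$. Let $\Gamma_\Pi^{\lambda}M=\Gamma^{\lambda_1}(\Pi M)\otimes\Gamma^{\lambda_2}(\Pi M)\otimes\cdots\subset(\Pi M)^{\otimes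 d}$ be the space of invariants of the Young subgroup $\mathfrak S_\lambda=\mathfrak S_{\lambda_1}\times\mathfrak S_{\lambda_2}\times\cdots$, and let $S^{\lambda'}M=S^{\lambda'_1}M\otimes S^{\lambda'_2}M\otimes\cdots$ be the coinvariants of $\mathfrak S_{\lambda'}$ in $M^{\otimes d}$, a quotient $S(m|n,d)$-module of $M^{\otimes d}$. The Schur supermodule $\widehat S_{\lambda'}(M)\subset S^{\lambda'}M$ is the $S(m|n,d)$-submodule which is the image of the composite $$\hat\theta_{\lambda'}:\ \Gamma_\Pi^{\lambda}M\hookrightarrow(\Pi M)^{\otimes d}\xrightarrow{\,1^{\otimes d}\,}M^{\otimes d}\xrightarrow{\,\cdot\,\sigma_{\lambda'}\,}M^{\otimes d}\twoheadrightarrow S^{\lambda'}M,$$ where $1:\Pi M\to M$ is the odd identity map (and $1^{\otimes d}$ acts by the rule of signs), and $\sigma_{\lambda'}$ sends the position of a cell in the row-by-row numbering of the diagram of $\lambda'$ to its position in the column-by-column numbering. Suppose that $l(\lambda')\le m$. Let $\mathfrak c_\lambda$ be the canonical tableau of shape $\lambda$, $\mathfrak c_\lambda(i,j)=j$, with reading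 word $\boldsymbol c$ (rows from left to right, and from top to bottom). Write $Z_\Pi^{(\mathfrak c_\lambda)}=\sum_{\sigma\in\mathfrak S_\lambda}Z_\Pi^{\boldsymbol c}.\sigma\in\Gamma_\Pi^\lambda M$, where $Z_\Pi^{\boldsymbol c}$ is the basis tensor of $(\Pi M)^{\otimes d}$, and write $Z_\Pi^{(\mathfrak c_\lambda)}$ also for the image of this element in $\widehat S_{\lambda'}(M)$. **Theorem.** Let $\lambda$ be a partition of $d$ with $l(\lambda')\le m$. A linear subspace (graded or not) of $\widehat S_{\lambda'}(M)$ is called an $N(m|n,d)$-submodule if it is stable under all elements of $N(m|n,d)$. Then: (i) every nonzero $N(m|n,d)$-submodule of $\widehat S_{\lambda'}(M)$ contains $Z_\Pi^{(\mathfrak c_\lambda)}$; (ii) the space of $N(m|n,d)$-invariants $\{v\in\widehat S_{\lambda'}(M): xv=0\text{ for all }x\in N(m|n,d)\}$ is the span of $Z_\Pi^{(\mathfrak c_\lambda)}$; (iii) $\widehat S_{\lambda'}(M)$ is $N(m|n,d)$-indecomposable: it is nonzero, and is not the direct sum of two nonzero $N(m|n,d)$-submodules. -/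

import Mathlib

open scoped TensorProduct

noncomputable section

namespace SchurSuper

/-! ### Signs

Parities and exponents of `-1` live in `ZMod 2`. -/

/-- The sign `(-1)^e`. -/
def sgn (k : Type*) [Field k] (e : ZMod 2) : k := (-1) ^ e.val

theorem sgn_add (k : Type*) [Field k] (a b : ZMod 2) : sgn k (a + b) = sgn k a * sgn k b := by
  have key : ∀ a b : ZMod 2, (a = 0 ∨ a = 1) ∧ (b = 0 ∨ b = 1) := by decide
  rcases key a b with ⟨rfl | rfl, rfl | rfl⟩ <;> simp [sgn, ZMod.val_one, show (1 : ZMod 2) + 1 = 0 from rfl]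

theorem sgn_mul_self (k : Type*) [Field k] (a : ZMod 2) : sgn k a * sgn k a = 1 := by
  rw [← sgn_add, CharTwo.add_self_eq_zero]; simp [sgn]

/-- The exponent of the sign `∏ (-1)^(ε_s ε_t)`, over all `s < t` with `σ⁻¹ s > σ⁻¹ t`. -/
def invSum {d : ℕ} (ε : Fin d → ZMod 2) (σ : Equiv.Perm (Fin d)) : ZMod 2 :=
  ∑ s, ∑ t, if s < t ∧ σ.symm t < σ.symm s then ε s * ε t else 0

/-- The exponent of the sign in the rule of signs
`(f_1 ⊗ ⋯ ⊗ f_d) (v_1 ⊗ ⋯ ⊗ v_d) = ± f_1 v_1 ⊗ ⋯ ⊗ f_d v_d`, for maps `f_s` of parity `ε_s` and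
vectors `v_s` of parity `δ_s`: each `f_t` moves past every `v_s` with `s < t`. -/
def ruleOfSigns {d : ℕ} (ε δ : Fin d → ZMod 2) : ZMod 2 :=
  ∑ s, ∑ t, if s < t then ε t * δ s else 0

theorem sum_fold {d : ℕ} (H : Fin d → Fin d → ZMod 2) (h0 : ∀ a, H a a = 0) :
    ∑ a, ∑ b, H a b = ∑ a, ∑ b, if a < b then H a b + H b a else 0 := by
  have h1 : ∑ a, ∑ b, (if a < b then H a b + H b a else 0) =
      ∑ a, ∑ b, (if a < b then H a b else 0) + ∑ a, ∑ b, (if b < a then H a b else 0) := by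
    rw [Finset.sum_comm (f := fun a b => if b < a then H a b else 0)]
    simp only [← Finset.sum_add_distrib]
    refine Finset.sum_congr rfl fun a _ => Finset.sum_congr rfl fun b _ => ?_
    split_ifs <;> simp
  rw [h1]
  simp only [← Finset.sum_add_distrib]
  refine Finset.sum_congr rfl fun a _ => Finset.sum_congr rfl fun b _ => ?_
  rcases lt_trichotomy a b with h | h | h
  · simp [h, h.not_gt]
  · subst h; simp [h0]
  · simp [h, h.not_gt]

theorem sum_reindex {d : ℕ} (σ : Equiv.Perm (Fin d)) (F : Fin d → Fin d → ZMod 2) :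
    ∑ s, ∑ t, F s t = ∑ a, ∑ b, F (σ.symm a) (σ.symm b) := by
  rw [← Equiv.sum_comp σ.symm]
  refine Finset.sum_congr rfl fun a _ => ?_
  rw [← Equiv.sum_comp σ.symm]

theorem sum_reindex_fold {d : ℕ} (σ : Equiv.Perm (Fin d)) (F : Fin d → Fin d → ZMod 2)
    (h0 : ∀ a, F a a = 0) :
    ∑ s, ∑ t, F s t = ∑ a, ∑ b, if a < b then
      F (σ.symm a) (σ.symm b) + F (σ.symm b) (σ.symm a) else 0 := by
  rw [sum_reindex σ F]
  exact sum_fold (fun a b => F (σ.symm a) (σ.symm b)) fun a => h0 _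

theorem invSum_mul {d : ℕ} (ε : Fin d → ZMod 2) (σ τ : Equiv.Perm (Fin d)) :
    invSum ε (σ * τ) = invSum ε σ + invSum (ε ∘ σ) τ := by
  unfold invSum
  rw [sum_reindex_fold σ
    (fun s t => if s < t ∧ τ.symm t < τ.symm s then (ε ∘ σ) s * (ε ∘ σ) t else 0)]
  · simp only [← Finset.sum_add_distrib]
    refine Finset.sum_congr rfl fun a _ => Finset.sum_congr rfl fun b _ => ?_
    by_cases hab : a < b
    swap
    · simp [hab]
    have e1 : ∀ c, (σ * τ).symm c = τ.symm (σ.symm c) := fun c => rfl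
    have hx : σ.symm a ≠ σ.symm b := fun h => hab.ne (σ.symm.injective h)
    have hu : τ.symm (σ.symm a) ≠ τ.symm (σ.symm b) := fun h => hx (τ.symm.injective h)
    simp only [e1, Function.comp, Equiv.apply_symm_apply, hab, true_and, if_true]
    rcases lt_or_gt_of_ne hx with h | h <;> rcases lt_or_gt_of_ne hu with h' | h' <;>
      simp [h, h', h.not_gt, h'.not_gt, mul_comm (ε b) (ε a), CharTwo.add_self_eq_zero]
  · intro a; simp

theorem invSum_add {d : ℕ} (P Q : Fin d → ZMod 2) (σ : Equiv.Perm (Fin d)) :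
    invSum (P + Q) σ =
      invSum P σ + invSum Q σ + ruleOfSigns P Q + ruleOfSigns (P ∘ σ) (Q ∘ σ) := by
  unfold invSum ruleOfSigns
  rw [sum_reindex_fold σ (fun s t => if s < t then (P ∘ σ) t * (Q ∘ σ) s else 0)]
  · simp only [← Finset.sum_add_distrib]
    refine Finset.sum_congr rfl fun a _ => Finset.sum_congr rfl fun b _ => ?_
    by_cases hab : a < b
    swap
    · simp [hab]
    have hx : σ.symm a ≠ σ.symm b := fun h => hab.ne (σ.symm.injective h)
    simp only [Function.comp, Equiv.apply_symm_apply, hab, true_and, if_true, Pi.add_apply]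
    have h2 : (2 : ZMod 2) = 0 := rfl
    rcases lt_or_gt_of_ne hx with h | h
    · simp only [h, h.not_gt, if_true, if_false]
      linear_combination (-(P b * Q a)) * h2
    · simp only [h, h.not_gt, if_true, if_false]
      ring
  · intro a; simp

/-- If the positions of odd parity carry pairwise distinct labels, then the sign of a permutation
only depends on the permuted sequence of labels. -/
theorem invSum_eq_of_comp_eq {d : ℕ} {α : Type*} (ε : Fin d → ZMod 2) (f : Fin d → α)
    (hf : ∀ a b, a ≠ b → ε a = 1 → ε b = 1 → f a ≠ f b) (hε : ∀ a b, f a = f b → ε a = ε b)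
    (σ τ : Equiv.Perm (Fin d)) (h : f ∘ σ = f ∘ τ) : invSum ε σ = invSum ε τ := by
  have key : ∀ a, ε a = 1 → σ.symm a = τ.symm a := by
    intro a ha
    have h1 : f a = f (τ (σ.symm a)) := by
      have := congrFun h (σ.symm a)
      simpa using this
    by_contra hne
    have hne' : a ≠ τ (σ.symm a) := fun e => hne (τ.eq_symm_apply.mpr e.symm)
    exact hf _ _ hne' ha ((hε _ _ h1) ▸ ha) h1
  have z : ∀ x : ZMod 2, x = 0 ∨ x = 1 := by decide
  unfold invSum
  refine Finset.sum_congr rfl fun a _ => Finset.sum_congr rfl fun b _ => ?_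
  rcases z (ε a) with ha | ha
  · simp [ha]
  rcases z (ε b) with hb | hb
  · simp [hb]
  rw [key a ha, key b hb]

/-! ### Tensor powers of superspaces

A finite dimensional superspace with a homogeneous basis is `Fin N → k` with its standard basis
`Z_1, …, Z_N` and a parity function `p : Fin N → ZMod 2`. -/

/-- The parity of the basis vectors `X_1 < ⋯ < X_m < Y_1 < ⋯ < Y_n` of `M = k^{m|n}`. -/
def parity (m n : ℕ) (a : Fin (m + n)) : ZMod 2 := if (a : ℕ) < m then 0 else 1

/-- The parity of the same basis vectors in the superspace `ΠM`. -/
def parityPi (m n : ℕ) (a : Fin (m + n)) : ZMod 2 := 1 + parity m n a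

/-- The underlying vector space of the `d`-th tensor power of `k^N`. -/
def TensorPow (k : Type*) [Field k] (N d : ℕ) : Type _ := ⨂[k] _ : Fin d, (Fin N → k)

instance (k : Type*) [Field k] (N d : ℕ) : AddCommGroup (TensorPow k N d) :=
  inferInstanceAs (AddCommGroup (⨂[k] _ : Fin d, (Fin N → k)))

instance (k : Type*) [Field k] (N d : ℕ) : Module k (TensorPow k N d) :=
  inferInstanceAs (Module k (⨂[k] _ : Fin d, (Fin N → k)))

/-- The basis `Z^i = Z_{i_1} ⊗ ⋯ ⊗ Z_{i_d}` of the tensor power. -/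
def Zw (k : Type*) [Field k] (N d : ℕ) :
    Module.Basis (Fin d → Fin N) k (TensorPow k N d) :=
  Basis.piTensorProduct fun _ => Pi.basisFun k (Fin N)

/-- The right action of a permutation on the tensor power of a superspace,
`Z^i . σ = sgn(|i|, σ) Z^{i.σ}` where `i.σ = i ∘ σ`. -/
def superPerm (k : Type*) [Field k] {N d : ℕ} (p : Fin N → ZMod 2) (σ : Equiv.Perm (Fin d)) :
    Module.End k (TensorPow k N d) :=
  (Zw k N d).constr k fun i => sgn k (invSum (p ∘ i) σ) • Zw k N d (i ∘ σ)

theorem superPerm_Zw (k : Type*) [Field k] {N d : ℕ} (p : Fin N → ZMod 2)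
    (σ : Equiv.Perm (Fin d)) (i : Fin d → Fin N) :
    superPerm k p σ (Zw k N d i) = sgn k (invSum (p ∘ i) σ) • Zw k N d (i ∘ σ) := by
  simp [superPerm]

/-! ### The Schur superalgebra -/

/-- The Schur superalgebra `S(m|n,d) = End_{k𝔖_d}(M^{⊗d})`, where `M = k^{m|n}`. -/
def schurAlgebra (k : Type*) [Field k] (m n d : ℕ) :
    Subalgebra k (Module.End k (TensorPow k (m + n) d)) :=
  Subalgebra.centralizer k (Set.range (superPerm k (d := d) (parity m n)))

/-- The endomorphism `E_{i_1,j_1} ⊗ ⋯ ⊗ E_{i_d,j_d}` of `M^{⊗d}`, where `E_{a,b}` are the matrix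
units; it acts by the rule of signs. -/
def tensorE (k : Type*) [Field k] (m n : ℕ) {d : ℕ} (i j : Fin d → Fin (m + n)) :
    Module.End k (TensorPow k (m + n) d) :=
  (Zw k (m + n) d).constr k fun l =>
    if l = j then
      sgn k (ruleOfSigns (parity m n ∘ i + parity m n ∘ j) (parity m n ∘ l)) • Zw k (m + n) d i
    else 0

/-- A pair of words is strict if no odd matrix unit occurs twice in `E_{i_1,j_1}, …, E_{i_d,j_d}`. -/
def IsStrict (m n : ℕ) {d : ℕ} (i j : Fin d → Fin (m + n)) : Prop :=
  ∀ a b, a ≠ b → parity m n (i a) + parity m n (j a) = 1 →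
    parity m n (i b) + parity m n (j b) = 1 → (i a, j a) ≠ (i b, j b)

open Classical in
/-- The coefficient of `E^{s,t}` in `E^{(i,j)}`: it is `sgn(|i| + |j|, τ)` if
`(s, t) = (i.τ, j.τ)` for a permutation `τ`, and `0` if there is no such `τ`.
For strict pairs it does not depend on the choice of `τ`. -/
def orbitCoeff (k : Type*) [Field k] (m n : ℕ) {d : ℕ} (i j s t : Fin d → Fin (m + n)) : k :=
  if h : ∃ τ : Equiv.Perm (Fin d), i ∘ τ = s ∧ j ∘ τ = t then
    sgn k (invSum (parity m n ∘ i + parity m n ∘ j) h.choose)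
  else 0

/-- The element `E^{(i,j)} = ∑ ± E^{s,t}`, the sum over the orbit of the pair `(i,j)`. -/
def dividedE (k : Type*) [Field k] (m n : ℕ) {d : ℕ} (i j : Fin d → Fin (m + n)) :
    Module.End k (TensorPow k (m + n) d) :=
  ∑ s, ∑ t, orbitCoeff k m n i j s t • tensorE k m n s t

theorem orbitCoeff_eq (k : Type*) [Field k] (m n : ℕ) {d : ℕ} {i j : Fin d → Fin (m + n)}
    (hij : IsStrict m n i j) (τ : Equiv.Perm (Fin d)) :
    orbitCoeff k m n i j (i ∘ τ) (j ∘ τ) =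
      sgn k (invSum (parity m n ∘ i + parity m n ∘ j) τ) := by
  have h : ∃ τ' : Equiv.Perm (Fin d), i ∘ τ' = i ∘ τ ∧ j ∘ τ' = j ∘ τ := ⟨τ, rfl, rfl⟩
  rw [orbitCoeff, dif_pos h]
  congr 1
  refine invSum_eq_of_comp_eq _ (fun a => (i a, j a)) (fun a b hab ha hb => hij a b hab ha hb)
    ?_ _ _ ?_
  · intro a b hab
    simp only [Prod.mk.injEq] at hab
    simp [hab.1, hab.2]
  · funext a
    exact Prod.ext (congrFun h.choose_spec.1 a) (congrFun h.choose_spec.2 a)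

theorem orbitCoeff_comp (k : Type*) [Field k] (m n : ℕ) {d : ℕ} {i j : Fin d → Fin (m + n)}
    (hij : IsStrict m n i j) (s t : Fin d → Fin (m + n)) (σ : Equiv.Perm (Fin d)) :
    orbitCoeff k m n i j (s ∘ σ) (t ∘ σ) =
      sgn k (invSum (parity m n ∘ s + parity m n ∘ t) σ) * orbitCoeff k m n i j s t := by
  by_cases h : ∃ τ : Equiv.Perm (Fin d), i ∘ τ = s ∧ j ∘ τ = t
  · obtain ⟨τ, rfl, rfl⟩ := h
    have e : ∀ f : Fin d → Fin (m + n), (f ∘ τ) ∘ σ = f ∘ (τ * σ : Equiv.Perm (Fin d)) :=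
      fun f => rfl
    rw [e i, e j, orbitCoeff_eq k m n hij, orbitCoeff_eq k m n hij, invSum_mul, sgn_add, mul_comm]
    rfl
  · have h' : ¬ ∃ τ : Equiv.Perm (Fin d), i ∘ τ = s ∘ σ ∧ j ∘ τ = t ∘ σ := by
      rintro ⟨τ, h1, h2⟩
      refine h ⟨τ * σ⁻¹, ?_, ?_⟩
      · funext a
        simpa using congrFun h1 (σ⁻¹ a)
      · funext a
        simpa using congrFun h2 (σ⁻¹ a)
    rw [orbitCoeff, dif_neg h', orbitCoeff, dif_neg h, mul_zero]

theorem dividedE_Zw (k : Type*) [Field k] (m n : ℕ) {d : ℕ} (i j l : Fin d → Fin (m + n)) :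
    dividedE k m n i j (Zw k (m + n) d l) =
      ∑ s, (orbitCoeff k m n i j s l *
        sgn k (ruleOfSigns (parity m n ∘ s + parity m n ∘ l) (parity m n ∘ l))) •
          Zw k (m + n) d s := by
  simp only [dividedE, LinearMap.sum_apply, LinearMap.smul_apply, tensorE,
    Module.Basis.constr_basis]
  refine Finset.sum_congr rfl fun s _ => ?_
  rw [Finset.sum_eq_single l]
  · simp [mul_smul]
  · intro t _ ht
    simp [ht.symm]
  · simp

theorem dividedE_mem (k : Type*) [Field k] (m n : ℕ) {d : ℕ} {i j : Fin d → Fin (m + n)}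
    (hij : IsStrict m n i j) : dividedE k m n i j ∈ schurAlgebra k m n d := by
  rw [schurAlgebra, Subalgebra.mem_centralizer_iff]
  rintro _ ⟨σ, rfl⟩
  refine (Zw k (m + n) d).ext fun l => ?_
  rw [Module.End.mul_apply, Module.End.mul_apply, superPerm_Zw, map_smul, dividedE_Zw, dividedE_Zw,
    map_sum, Finset.smul_sum]
  rw [← Equiv.sum_comp (Equiv.arrowCongr σ.symm (Equiv.refl (Fin (m + n))))
    (fun s => sgn k (invSum (parity m n ∘ l) σ) • _)]
  refine Finset.sum_congr rfl fun s _ => ?_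
  have e : (Equiv.arrowCongr σ.symm (Equiv.refl (Fin (m + n)))) s = s ∘ σ := rfl
  rw [e, map_smul, superPerm_Zw, smul_smul, smul_smul, orbitCoeff_comp k m n hij]
  congr 1
  set P : Fin d → ZMod 2 := parity m n ∘ s + parity m n ∘ l with hP
  set Q : Fin d → ZMod 2 := parity m n ∘ l with hQ
  have h1 : parity m n ∘ s = P + Q := by
    funext a
    simp [hP, hQ, add_assoc, CharTwo.add_self_eq_zero]
  have h2 : parity m n ∘ (s ∘ σ) + parity m n ∘ (l ∘ σ) = P ∘ σ := rfl
  have h3 : parity m n ∘ (l ∘ σ) = Q ∘ σ := rfl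
  rw [h2, h3, h1, invSum_add, sgn_add, sgn_add, sgn_add]
  linear_combination (orbitCoeff k m n i j s l * sgn k (invSum P σ) * sgn k (invSum Q σ) *
    sgn k (ruleOfSigns (P ∘ σ) (Q ∘ σ))) * sgn_mul_self k (ruleOfSigns P Q)

/-- `E^{(i,j)}`, for a strict pair `(i,j)`, as an element of the Schur superalgebra. -/
def schurE (k : Type*) [Field k] (m n : ℕ) {d : ℕ} (i j : Fin d → Fin (m + n))
    (hij : IsStrict m n i j) : schurAlgebra k m n d :=
  ⟨dividedE k m n i j, dividedE_mem k m n hij⟩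

/-- `N(m|n,d)`: the span of the elements `E^{(i,j)}`, for strict pairs `(i,j)` with `i ≺ j` in the
lexicographic order. As `E^{(i,j)}` is, up to sign, the same element for all pairs
`(i.σ, j.σ)` of the orbit of `(i,j)`, the condition is imposed on the orbit, that is, on each of
these pairs; it says that `i_r ≤ j_r` for all `r`, and `i ≠ j`. -/
def upperN (k : Type*) [Field k] (m n d : ℕ) : Submodule k (schurAlgebra k m n d) :=
  Submodule.span k {x | ∃ (i j : Fin d → Fin (m + n)) (hij : IsStrict m n i j),
    (∀ σ : Equiv.Perm (Fin d), toLex (i ∘ σ) < toLex (j ∘ σ)) ∧ x = schurE k m n i j hij}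

/-! ### Young diagrams

A partition `λ` of `d` is a Young diagram with `d` cells; its conjugate is `λ.transpose`. Rows,
columns and positions are numbered from `0`. -/

theorem card_transpose {lam : YoungDiagram} {d : ℕ} (h : lam.card = d) :
    lam.transpose.card = d := by
  rw [← h, YoungDiagram.card, YoungDiagram.card, YoungDiagram.transpose]
  exact Finset.card_map _

/-- The numbering of the cells of a diagram by their positions in the reading word: left to right
in the rows, and the rows from top to bottom. -/
def reading (lam : YoungDiagram) {d : ℕ} (h : lam.card = d) : Fin d ≃ {c // c ∈ lam.cells} :=
  ((lam.cells.map (toLex (α := ℕ × ℕ)).toEmbedding).orderIsoOfFin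
      (by rw [Finset.card_map]; exact h)).toEquiv.trans
    ((toLex (α := ℕ × ℕ)).symm.subtypeEquiv fun c => by
      simp only [Finset.mem_map, Equiv.coe_toEmbedding]
      exact ⟨by rintro ⟨x, hx, rfl⟩; exact hx, fun hc => ⟨_, hc, rfl⟩⟩)

/-- The cell `(i,j)` of a diagram corresponds to the cell `(j,i)` of the conjugate diagram. -/
def swapCells (lam : YoungDiagram) :
    {c // c ∈ lam.cells} ≃ {c // c ∈ lam.transpose.cells} :=
  (Equiv.prodComm ℕ ℕ).subtypeEquiv fun c => by
    rw [YoungDiagram.mem_cells, YoungDiagram.mem_cells, YoungDiagram.mem_transpose]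
    rfl

/-- The permutation `σ_λ`: it sends the position of a cell in the row-by-row numbering of the
diagram to the position of the same cell in the column-by-column numbering. -/
def sigmaPerm (lam : YoungDiagram) {d : ℕ} (h : lam.card = d) : Equiv.Perm (Fin d) :=
  ((reading lam h).trans (swapCells lam)).trans (reading lam.transpose (card_transpose h)).symm

/-- The Young subgroup `𝔖_{λ_1} × 𝔖_{λ_2} × ⋯` of `𝔖_d`: it consists of the permutations that keep
every position of the reading word in its row. -/
def IsYoung (lam : YoungDiagram) {d : ℕ} (h : lam.card = d) (σ : Equiv.Perm (Fin d)) : Prop :=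
  ∀ r, (reading lam h (σ r)).1.1 = (reading lam h r).1.1

/-! ### The functors `Γ_Π^λ` and `S^λ` at `M` -/

/-- `Γ_Π^λ M = Γ^{λ_1}(ΠM) ⊗ Γ^{λ_2}(ΠM) ⊗ ⋯`, the invariants of the Young subgroup in
`(ΠM)^{⊗d}`. -/
def gammaPi (k : Type*) [Field k] (m n : ℕ) (lam : YoungDiagram) {d : ℕ} (h : lam.card = d) :
    Submodule k (TensorPow k (m + n) d) where
  carrier := {w | ∀ σ, IsYoung lam h σ → superPerm k (parityPi m n) σ w = w}
  add_mem' ha hb σ hσ := by rw [map_add, ha σ hσ, hb σ hσ]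
  zero_mem' σ _ := map_zero _
  smul_mem' c w hw σ hσ := by rw [map_smul, hw σ hσ]

/-- The kernel of the projection from `M^{⊗d}` to the coinvariants of the Young subgroup. It is an
`S(m|n,d)`-submodule. -/
def symKer (k : Type*) [Field k] (m n : ℕ) (lam : YoungDiagram) {d : ℕ} (h : lam.card = d) :
    Submodule (schurAlgebra k m n d) (TensorPow k (m + n) d) where
  toAddSubmonoid := (Submodule.span k {w : TensorPow k (m + n) d | ∃ σ v, IsYoung lam h σ ∧
    w = superPerm k (parity m n) σ v - v}).toAddSubmonoid
  smul_mem' x w hw := by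
    change (x : Module.End k (TensorPow k (m + n) d)) w ∈ Submodule.span k _
    change w ∈ Submodule.span k _ at hw
    refine Submodule.span_induction ?_ ?_ ?_ ?_ hw
    · rintro _ ⟨σ, v, hσ, rfl⟩
      refine Submodule.subset_span ⟨σ, x.1 v, hσ, ?_⟩
      have hx := (Subalgebra.mem_centralizer_iff k).1 x.2 _ ⟨σ, rfl⟩
      rw [map_sub]
      congr 1
      exact (LinearMap.congr_fun hx v).symm
    · rw [map_zero]; exact Submodule.zero_mem _
    · intro a b _ _ ha hb
      rw [map_add]; exact Submodule.add_mem _ ha hb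
    · intro c a _ ha
      rw [map_smul]; exact Submodule.smul_mem _ _ ha

/-- `S^λ M = S^{λ_1} M ⊗ S^{λ_2} M ⊗ ⋯`, the coinvariants of the Young subgroup in `M^{⊗d}`, as an
`S(m|n,d)`-module. -/
abbrev SymPow (k : Type*) [Field k] (m n : ℕ) (lam : YoungDiagram) {d : ℕ} (h : lam.card = d) :
    Type _ :=
  TensorPow k (m + n) d ⧸ symKer k m n lam h

/-! ### Schur supermodules -/

/-- The map `1^{⊗d} : (ΠM)^{⊗d} → M^{⊗d}`, where `1 : ΠM → M` is the odd identity map; it acts by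
the rule of signs. -/
def unPi (k : Type*) [Field k] (m n d : ℕ) : Module.End k (TensorPow k (m + n) d) :=
  (Zw k (m + n) d).constr k fun i =>
    sgn k (ruleOfSigns (fun _ => 1) (parityPi m n ∘ i)) • Zw k (m + n) d i

theorem unPi_Zw (k : Type*) [Field k] (m n : ℕ) {d : ℕ} (i : Fin d → Fin (m + n)) :
    unPi k m n d (Zw k (m + n) d i) =
      sgn k (ruleOfSigns (fun _ => 1) (parityPi m n ∘ i)) • Zw k (m + n) d i := by
  simp [unPi]

theorem unPi_unPi (k : Type*) [Field k] (m n : ℕ) {d : ℕ} (v : TensorPow k (m + n) d) :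
    unPi k m n d (unPi k m n d v) = v := by
  have : unPi k m n d * unPi k m n d = 1 := by
    refine (Zw k (m + n) d).ext fun i => ?_
    rw [Module.End.mul_apply, unPi_Zw, map_smul, unPi_Zw, smul_smul, sgn_mul_self, one_smul]
    rfl
  exact LinearMap.congr_fun this v

theorem unPi_superPerm (k : Type*) [Field k] (m n : ℕ) {d : ℕ} (σ : Equiv.Perm (Fin d))
    (v : TensorPow k (m + n) d) :
    unPi k m n d (superPerm k (parityPi m n) σ v) =
      sgn k (invSum (fun _ => 1) σ) • superPerm k (parity m n) σ (unPi k m n d v) := by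
  have : unPi k m n d * superPerm k (parityPi m n) σ =
      sgn k (invSum (fun _ => 1) σ) • (superPerm k (parity m n) σ * unPi k m n d) := by
    refine (Zw k (m + n) d).ext fun i => ?_
    rw [LinearMap.smul_apply, Module.End.mul_apply, Module.End.mul_apply, superPerm_Zw, map_smul,
      unPi_Zw, unPi_Zw, map_smul, superPerm_Zw, smul_smul, smul_smul, smul_smul]
    congr 1
    set P : Fin d → ZMod 2 := fun _ => 1 with hP
    set Q : Fin d → ZMod 2 := parityPi m n ∘ i with hQ
    have h1 : parity m n ∘ i = P + Q := by
      funext a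
      simp [hP, hQ, parityPi, ← add_assoc, CharTwo.add_self_eq_zero]
    have h2 : parityPi m n ∘ (i ∘ σ) = Q ∘ σ := rfl
    have h3 : ruleOfSigns P (Q ∘ σ) = ruleOfSigns (P ∘ σ) (Q ∘ σ) := rfl
    rw [h2, h3, h1, invSum_add, sgn_add, sgn_add, sgn_add]
    linear_combination (-(sgn k (invSum Q σ) * sgn k (ruleOfSigns (P ∘ σ) (Q ∘ σ)))) *
      sgn_mul_self k (invSum P σ) -
      sgn k (invSum P σ) * sgn k (invSum P σ) * sgn k (invSum Q σ) *
        sgn k (ruleOfSigns (P ∘ σ) (Q ∘ σ)) * sgn_mul_self k (ruleOfSigns P Q)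
  exact LinearMap.congr_fun this v

/-- The map `θ̂_λ : Γ_Π^{λ'} M → S^λ M`: include `Γ_Π^{λ'} M` into `(ΠM)^{⊗d}`, pass to `M^{⊗d}`, let
`σ_λ` act, and multiply. -/
def thetaHat (k : Type*) [Field k] (m n : ℕ) (lam : YoungDiagram) {d : ℕ} (h : lam.card = d) :
    gammaPi k m n lam.transpose (card_transpose h) →ₗ[k] SymPow k m n lam h :=
  (((symKer k m n lam h).mkQ.restrictScalars k ∘ₗ superPerm k (parity m n) (sigmaPerm lam h)) ∘ₗ
    unPi k m n d) ∘ₗ (gammaPi k m n lam.transpose (card_transpose h)).subtype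

/-- The Schur supermodule `Ŝ_λ(M)`: the image of `θ̂_λ`, an `S(m|n,d)`-submodule of `S^λ M`. -/
def schurSupermodule (k : Type*) [Field k] (m n : ℕ) (lam : YoungDiagram) {d : ℕ}
    (h : lam.card = d) : Submodule (schurAlgebra k m n d) (SymPow k m n lam h) where
  toAddSubmonoid := (LinearMap.range (thetaHat k m n lam h)).toAddSubmonoid
  smul_mem' x w hw := by
    obtain ⟨⟨w, hw⟩, rfl⟩ := hw
    have hx : ∀ σ v, superPerm k (parity m n) σ (x.1 v) = x.1 (superPerm k (parity m n) σ v) :=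
      fun σ v => LinearMap.congr_fun ((Subalgebra.mem_centralizer_iff k).1 x.2 _ ⟨σ, rfl⟩) v
    refine ⟨⟨unPi k m n d (x.1 (unPi k m n d w)), ?_⟩, ?_⟩
    · intro σ hσ
      have h1 := unPi_superPerm k m n σ (unPi k m n d (x.1 (unPi k m n d w)))
      rw [unPi_unPi, hx, ← map_smul] at h1
      rw [← unPi_unPi k m n (superPerm k (parityPi m n) σ _), h1, ← unPi_superPerm, hw σ hσ]
    · change (symKer k m n lam h).mkQ (superPerm k (parity m n) (sigmaPerm lam h)
        (unPi k m n d (unPi k m n d (x.1 (unPi k m n d w))))) =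
        (symKer k m n lam h).mkQ (x • superPerm k (parity m n) (sigmaPerm lam h) (unPi k m n d w))
      rw [unPi_unPi, hx]
      rfl

/-! ### The canonical element -/

open Classical in
/-- The element `Z_Π^{(t)}` of the tableau with reading word `t`, as an element of `(ΠM)^{⊗d}`: the
signed sum of the `Z_Π^s` over the words `s` of the row equivalent tableaux. -/
def dividedZ (k : Type*) [Field k] (m n : ℕ) (lam : YoungDiagram) {d : ℕ} (h : lam.card = d)
    (t : Fin d → Fin (m + n)) : TensorPow k (m + n) d :=
  ∑ s, if hs : ∃ τ : Equiv.Perm (Fin d), IsYoung lam h τ ∧ t ∘ τ = s then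
    sgn k (invSum (parityPi m n ∘ t) hs.choose) • Zw k (m + n) d s
  else 0

theorem dividedZ_mem (k : Type*) [Field k] (m n : ℕ) (lam : YoungDiagram) {d : ℕ}
    (h : lam.card = d) (t : Fin d → Fin (m + n))
    (ht : ∀ a b, a ≠ b → parityPi m n (t a) = 1 → parityPi m n (t b) = 1 →
      (t a, (reading lam h a).1.1) ≠ (t b, (reading lam h b).1.1)) :
    dividedZ k m n lam h t ∈ gammaPi k m n lam h := by
  classical
  intro σ hσ
  rw [dividedZ, map_sum, ← Equiv.sum_comp (Equiv.arrowCongr σ.symm (Equiv.refl (Fin (m + n))))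
    (fun s => dite (∃ τ : Equiv.Perm (Fin d), IsYoung lam h τ ∧ t ∘ τ = s) _ _)]
  refine Finset.sum_congr rfl fun s _ => ?_
  have e : (Equiv.arrowCongr σ.symm (Equiv.refl (Fin (m + n)))) s = s ∘ σ := rfl
  rw [e]
  by_cases hs : ∃ τ : Equiv.Perm (Fin d), IsYoung lam h τ ∧ t ∘ τ = s
  · have hs' : ∃ τ : Equiv.Perm (Fin d), IsYoung lam h τ ∧ t ∘ τ = s ∘ σ := by
      obtain ⟨τ, hτ, rfl⟩ := hs
      exact ⟨τ * σ, fun r => (hτ (σ r)).trans (hσ r), rfl⟩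
    rw [dif_pos hs, dif_pos hs', map_smul, superPerm_Zw, smul_smul, ← sgn_add]
    congr 2
    have h1 : parityPi m n ∘ s = (parityPi m n ∘ t) ∘ hs.choose := by
      rw [Function.comp_assoc, hs.choose_spec.2]
    rw [h1, ← invSum_mul]
    refine invSum_eq_of_comp_eq _ (fun a => (t a, (reading lam h a).1.1))
      (fun a b hab ha hb => ht a b hab ha hb) ?_ _ _ ?_
    · intro a b hab
      simp only [Prod.mk.injEq] at hab
      simp [hab.1]
    · funext r
      refine Prod.ext ?_ ?_
      · have h2 := congrFun hs'.choose_spec.2 r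
        have h3 := congrFun hs.choose_spec.2 (σ r)
        exact h3.trans h2.symm
      · exact ((hs.choose_spec.1 (σ r)).trans (hσ r)).trans (hs'.choose_spec.1 r).symm
  · have hs' : ¬ ∃ τ : Equiv.Perm (Fin d), IsYoung lam h τ ∧ t ∘ τ = s ∘ σ := by
      rintro ⟨τ, hτ, h1⟩
      refine hs ⟨τ * σ⁻¹, fun r => (hτ (σ⁻¹ r)).trans ?_, ?_⟩
      · have := hσ (σ⁻¹ r)
        simpa using this.symm
      · funext a
        simpa using congrFun h1 (σ⁻¹ a)
    rw [dif_neg hs, dif_neg hs', map_zero]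

theorem col_lt {m : ℕ} {lam : YoungDiagram} (hl : lam.transpose.colLen 0 ≤ m)
    (c : {c // c ∈ lam.cells}) : c.1.2 < m := by
  refine lt_of_lt_of_le ?_ hl
  rw [← YoungDiagram.mem_iff_lt_colLen, YoungDiagram.mem_transpose]
  have hc : (c.1.1, c.1.2) ∈ lam := (YoungDiagram.mem_cells _).1 c.2
  exact lam.up_left_mem (Nat.zero_le _) le_rfl hc

/-- The reading word of the canonical tableau, `𝔠_λ(i,j) = j`, if all columns of the diagram have
number at most `m`. -/
def canonicalWord (m n : ℕ) (lam : YoungDiagram) {d : ℕ} (h : lam.card = d)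
    (hl : lam.transpose.colLen 0 ≤ m) : Fin d → Fin (m + n) :=
  fun r => ⟨(reading lam h r).1.2, (col_lt hl _).trans_le (Nat.le_add_right m n)⟩

theorem canonicalWord_mem (k : Type*) [Field k] (m n : ℕ) (lam : YoungDiagram) {d : ℕ}
    (h : lam.card = d) (hl : lam.transpose.colLen 0 ≤ m) :
    dividedZ k m n lam h (canonicalWord m n lam h hl) ∈
      gammaPi k m n lam.transpose.transpose (card_transpose (card_transpose h)) := by
  have key : ∀ (mu : YoungDiagram) (hmu : mu.card = d), mu = lam →
      dividedZ k m n lam h (canonicalWord m n lam h hl) ∈ gammaPi k m n mu hmu := by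
    rintro mu hmu rfl
    refine dividedZ_mem k m n mu h _ fun a b hab _ _ he => hab ?_
    simp only [canonicalWord, Prod.mk.injEq, Fin.mk.injEq] at he
    exact (reading mu h).injective (Subtype.ext (Prod.ext he.2 he.1))
  exact key _ _ lam.transpose_transpose

/-- The canonical element `Z_Π^{(𝔠_λ)}` of `Ŝ_{λ'}(M)`, that is, its image under
`θ̂_{λ'} : Γ_Π^λ M → Ŝ_{λ'}(M)`. -/
def canonicalElement (k : Type*) [Field k] (m n : ℕ) (lam : YoungDiagram) {d : ℕ}
    (h : lam.card = d) (hl : lam.transpose.colLen 0 ≤ m) :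
    schurSupermodule k m n lam.transpose (card_transpose h) :=
  ⟨thetaHat k m n lam.transpose (card_transpose h)
    ⟨dividedZ k m n lam h (canonicalWord m n lam h hl), canonicalWord_mem k m n lam h hl⟩,
    LinearMap.mem_range_self _ _⟩

/-! ### Submodules, invariants, indecomposability -/

/-- A linear subspace is an `N`-submodule if it is stable under the elements of `N`. -/
def IsNSubmodule {k A V : Type*} [Field k] [Ring A] [Algebra k A] [AddCommGroup V] [Module k V]
    [Module A V] (N : Submodule k A) (W : Submodule k V) : Prop :=
  ∀ x ∈ N, ∀ v ∈ W, x • v ∈ W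

/-- The space of `N`-invariants: the vectors that are killed by all elements of `N`. -/
def nInvariants {k A V : Type*} [Field k] [Ring A] [Algebra k A] [AddCommGroup V] [Module k V]
    [Module A V] [IsScalarTower k A V] (N : Submodule k A) : Submodule k V where
  carrier := {v | ∀ x ∈ N, x • v = 0}
  add_mem' ha hb x hx := by rw [smul_add, ha x hx, hb x hx, add_zero]
  zero_mem' x _ := smul_zero x
  smul_mem' c v hv x hx := by rw [← algebraMap_smul A c v, ← mul_smul, ← Algebra.commutes c x, mul_smul, hv x hx, smul_zero]

/-- `V` is `N`-indecomposable: it is nonzero, and not the direct sum of two nonzero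
`N`-submodules. -/
def IsNIndecomposable {k A V : Type*} [Field k] [Ring A] [Algebra k A] [AddCommGroup V]
    [Module k V] [Module A V] (N : Submodule k A) : Prop :=
  Nontrivial V ∧ ∀ W₁ W₂ : Submodule k V, IsNSubmodule N W₁ → IsNSubmodule N W₂ →
    IsCompl W₁ W₂ → W₁ = ⊥ ∨ W₂ = ⊥

end SchurSuper

end

/-!
Write `c` for the word of the row numbers of the diagram `λ'`. Every element of `Ŝ_{λ'}(M)` lifts
to a tensor in `M^{⊗d}` on which the permutations within the columns act by their signs. As
`2 ≠ 0`, the coordinate of such a tensor at a word with a repeated even letter in a column vanishes.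
Hence, among the words `i ≤ c` (letter by letter), only `i = c` is the weight of a nonzero such
tensor, and the tensors of this weight form a line, which lifts the line of `Z_Π^{(𝔠_λ)}`.
Consequently `N(m|n,d)` kills `Z_Π^{(𝔠_λ)}`.

Conversely, let `v` be a tensor of this kind with nonzero image in the coinvariants. Among the
representatives of this image choose one, `w`, which is reduced, so that none of its terms can be
expressed by the others modulo the kernel, and among the words `j` that occur in `w` choose one for
which `∑ c_r j_r` is maximal. Put `i = min(c, j)`, letter by letter. By the rearrangement
inequality, `Z^j` is the only term of `w` that contributes to the coefficient of `Z^i` in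
`E^{(i,j)} w`, so `E^{(i,j)} v ≠ 0`. Its weight is `i ≤ c`, hence `i = c`, and `E^{(c,j)} v` spans
the canonical line. So each vector outside the canonical line is mapped to `Z_Π^{(𝔠_λ)}` by an
element of `N(m|n,d)`.
-/

noncomputable section

namespace SchurSuper

theorem sgn_zero (k : Type*) [Field k] : sgn k 0 = 1 := by simp [sgn]

theorem sgn_one (k : Type*) [Field k] : sgn k 1 = -1 := by simp [sgn, ZMod.val_one]

theorem sgn_ne_zero (k : Type*) [Field k] (e : ZMod 2) : sgn k e ≠ 0 :=
  left_ne_zero_of_mul_eq_one (sgn_mul_self k e)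

theorem invSum_zero {d : ℕ} (σ : Equiv.Perm (Fin d)) : invSum 0 σ = 0 := by
  simp [invSum]

theorem invSum_swap {d : ℕ} {ε : Fin d → ZMod 2} {x y : Fin d} (hxy : x ≠ y) (hε : ε x = ε y) :
    invSum ε (Equiv.swap x y) = ε x := by
  wlog hlt : x < y generalizing x y
  · rw [Equiv.swap_comm, this hxy.symm hε.symm (lt_of_le_of_ne (not_lt.1 hlt) hxy.symm), hε]
  have mul_self : ∀ a : ZMod 2, a * a = a := by decide
  have hswap : ∀ r, ε (Equiv.swap x y r) = ε r := Equiv.apply_swap_eq_self hε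
  simp only [invSum, Equiv.symm_swap, ← Fintype.sum_prod_type']
  rw [← Finset.add_sum_erase _ _ (Finset.mem_univ (x, y))]
  -- The inversions `(s, t)` and `(swap t, swap s)` cancel; only `(x, y)` is paired with itself.
  rw [Finset.sum_involution fun p _ => (Equiv.swap x y p.2, Equiv.swap x y p.1)]
  · simp [hlt, ← hε, mul_self]
  · rintro ⟨s, t⟩ -
    simp only [Equiv.swap_apply_self, hswap, and_comm (a := s < t), mul_comm (ε t)]
    exact CharTwo.add_self_eq_zero _
  · rintro ⟨s, t⟩ hst hne heq
    obtain ⟨h1, _⟩ := Prod.mk.inj heq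
    simp only [← h1, Equiv.swap_apply_self] at hne hst
    grind
  · rintro ⟨s, t⟩ hst
    simp only [Finset.mem_erase, Finset.mem_univ, and_true, ne_eq, Prod.mk.injEq] at hst ⊢
    rintro ⟨h1, h2⟩
    simp_all [Equiv.swap_apply_eq_iff]
  · rintro ⟨s, t⟩ -
    simp

section Basis

variable {ι K V : Type*} [Field K] [AddCommGroup V] [Module K V] (b : Module.Basis ι K V)

theorem repr_apply_of_apply_basis_eq_smul {f : Module.End K V} {a : ι → K} {e : ι → ι}
    (he : Function.Injective e) (hf : ∀ i, f (b i) = a i • b (e i)) (v : V) (i : ι) :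
    b.repr (f v) (e i) = a i * b.repr v i := by
  have : b.coord (e i) ∘ₗ f = a i • b.coord i := by
    refine b.ext fun j => ?_
    rcases eq_or_ne j i with rfl | hji
    · simp [hf]
    · simp [hf, Finsupp.single_eq_of_ne' hji, Finsupp.single_eq_of_ne' (he.ne hji)]
  exact LinearMap.congr_fun this v

theorem exists_sub_mem_forall_support_subset (S : Submodule K V) (v : V) :
    ∃ w, v - w ∈ S ∧ ∀ z ∈ S, (b.repr z).support ⊆ (b.repr w).support → z = 0 := by
  obtain ⟨w, hvw, hmin⟩ := (measure fun w => (b.repr w).support.card).wf.has_min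
    {w | v - w ∈ S} ⟨v, by simp⟩
  refine ⟨w, hvw, fun z hz hsupp => ?_⟩
  by_contra hz0
  obtain ⟨i, hi⟩ := Finsupp.support_nonempty_iff.2 (b.repr.map_ne_zero_iff.2 hz0)
  set w' := w - (b.repr w i / b.repr z i) • z
  have hvw' : v - w' ∈ S := by
    rw [sub_sub_eq_add_sub, add_sub_right_comm]
    exact S.add_mem hvw (S.smul_mem _ hz)
  refine hmin w' hvw' (Finset.card_lt_card ⟨fun l hl => ?_, fun hsub => ?_⟩)
  · by_contra hl'
    have hlz := mt (@hsupp l) hl'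
    simp_all [w']
  · have := hsub (hsupp hi)
    simp_all [w']

end Basis

section Socle

variable {k A V : Type*} [Field k] [Ring A] [Algebra k A] [AddCommGroup V] [Module k V]
  [Module A V] {N : Submodule k A} {z : V}

theorem smul_eq_zero_of_mem_span [IsScalarTower k A V] {S : Set A} (v : V)
    (hS : ∀ x ∈ S, x • v = 0) {x : A} (hx : x ∈ Submodule.span k S) : x • v = 0 := by
  induction hx using Submodule.span_induction with
  | mem x hx => exact hS x hx
  | zero => exact zero_smul A v
  | add x y _ _ hx hy => rw [add_smul, hx, hy, add_zero]
  | smul a x _ hx => rw [smul_assoc, hx, smul_zero]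

theorem mem_of_isNSubmodule_of_ne_bot
    (hz : ∀ v ∉ Submodule.span k {z}, ∃ x ∈ N, x • v = z) {W : Submodule k V}
    (hW : IsNSubmodule N W) (hW0 : W ≠ ⊥) : z ∈ W := by
  obtain ⟨v, hv, hv0⟩ := W.ne_bot_iff.1 hW0
  by_cases hspan : v ∈ Submodule.span k {z}
  · obtain ⟨a, rfl⟩ := Submodule.mem_span_singleton.1 hspan
    exact (W.smul_mem_iff (left_ne_zero_of_smul hv0)).1 hv
  · obtain ⟨x, hx, rfl⟩ := hz v hspan
    exact hW x hx v hv

theorem nInvariants_eq_span_singleton [IsScalarTower k A V]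
    (hz : ∀ v ∉ Submodule.span k {z}, ∃ x ∈ N, x • v = z) (hz0 : z ≠ 0)
    (hNz : ∀ x ∈ N, x • z = 0) : nInvariants N = Submodule.span k {z} := by
  refine le_antisymm (fun v hv => ?_) ((Submodule.span_singleton_le_iff_mem _ _).2 hNz)
  by_contra hspan
  obtain ⟨x, hx, rfl⟩ := hz v hspan
  exact hz0 (hv x hx)

theorem isNIndecomposable_of_forall_mem (hz0 : z ≠ 0)
    (hz : ∀ W : Submodule k V, IsNSubmodule N W → W ≠ ⊥ → z ∈ W) :
    IsNIndecomposable (V := V) N := by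
  refine ⟨⟨z, 0, hz0⟩, fun W₁ W₂ hW₁ hW₂ hcompl => ?_⟩
  by_contra! hne
  exact hz0 (Submodule.disjoint_def.1 hcompl.disjoint z (hz W₁ hW₁ hne.1) (hz W₂ hW₂ hne.2))

end Socle

section Words

variable {ι α : Type*} [Finite ι]

theorem comp_perm_eq_of_le [PartialOrder α] {f : ι → α} {τ : Equiv.Perm ι} (h : f ∘ τ ≤ f) :
    f ∘ τ = f := by
  have hanti : Antitone fun e : ℕ => f ∘ ⇑(τ ^ e) := by
    refine antitone_nat_of_succ_le fun e r => ?_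
    simpa [pow_succ'] using h ((τ ^ e) r)
  refine le_antisymm h ?_
  simpa [pow_orderOf_eq_one] using hanti (orderOf_pos τ)

theorem inf_comp_perm_eq [SemilatticeInf α] {x y : ι → α} {ρ τ : Equiv.Perm ι} (hx : x ∘ ρ = x)
    (hy : y ∘ τ = y) (h : (x ⊓ y) ∘ τ = (x ⊓ y) ∘ ρ) : (x ⊓ y) ∘ τ = x ⊓ y := by
  refine comp_perm_eq_of_le (le_inf ?_ ?_)
  · calc (x ⊓ y) ∘ τ = (x ⊓ y) ∘ ρ := h
      _ ≤ x ∘ ρ := fun r => inf_le_left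
      _ = x := hx
  · calc (x ⊓ y) ∘ τ ≤ y ∘ τ := fun r => inf_le_right
      _ = y := hy

theorem exists_perm_comp_eq_of_card_fiber_eq {f g : ι → α}
    (h : ∀ a, Nat.card {r // f r = a} = Nat.card {r // g r = a}) :
    ∃ ρ : Equiv.Perm ι, f ∘ ρ = g :=
  ⟨Equiv.ofFiberEquiv fun a => Classical.choice (Finite.card_eq.1 (h a).symm),
    funext fun r => Equiv.ofFiberEquiv_map _ r⟩

end Words

section Exchange

variable {ι α R : Type*} [Fintype ι] [LinearOrder α] [CommRing R] {x y : ι → α}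
  {σ : Equiv.Perm ι}

theorem sum_mul_comp_perm (hσ : (x ⊓ y) ∘ σ = x ⊓ y) (F G : α → R) :
    ∑ r, F (x r) * G (y (σ r)) = ∑ r, F (x r) * G (y r) +
      ∑ r, (F (x r) - F ((x ⊓ y) r)) * (G (y (σ r)) - G ((x ⊓ y) r)) := by
  have hσ' : ∑ r, F ((x ⊓ y) r) * G (y (σ r)) = ∑ r, F ((x ⊓ y) r) * G (y r) := by
    rw [← Equiv.sum_comp σ fun r => F ((x ⊓ y) r) * G (y r)]
    exact Finset.sum_congr rfl fun r _ => by rw [show (x ⊓ y) (σ r) = _ from congrFun hσ r]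
  have hterm : ∀ r, F (x r) * G (y (σ r)) = F (x r) * G (y r) +
      (F (x r) - F ((x ⊓ y) r)) * (G (y (σ r)) - G ((x ⊓ y) r)) +
      (F ((x ⊓ y) r) * G (y (σ r)) - F ((x ⊓ y) r) * G (y r)) := by
    intro r
    have hxy : (F (x r) - F ((x ⊓ y) r)) * (G (y r) - G ((x ⊓ y) r)) = 0 := by
      rcases le_total (x r) (y r) with h | h <;> simp [h]
    linear_combination -hxy
  rw [Finset.sum_congr rfl fun r _ => hterm r, Finset.sum_add_distrib, Finset.sum_add_distrib,
    Finset.sum_sub_distrib, hσ', sub_self, add_zero]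

variable [LinearOrder R] [IsStrictOrderedRing R]

theorem eq_inf_or_comp_perm_eq_inf {q : α → R} (hq : StrictMono q) (hσ : (x ⊓ y) ∘ σ = x ⊓ y)
    (hle : ∑ r, q (x r) * q (y (σ r)) ≤ ∑ r, q (x r) * q (y r)) (r : ι) :
    x r = (x ⊓ y) r ∨ y (σ r) = (x ⊓ y) r := by
  have hnonneg : ∀ r, 0 ≤ (q (x r) - q ((x ⊓ y) r)) * (q (y (σ r)) - q ((x ⊓ y) r)) := by
    refine fun r => mul_nonneg (sub_nonneg.2 (hq.monotone inf_le_left)) ?_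
    rw [← congrFun hσ r]
    exact sub_nonneg.2 (hq.monotone inf_le_right)
  rw [sum_mul_comp_perm hσ, add_le_iff_nonpos_right] at hle
  have hzero := (Finset.sum_eq_zero_iff_of_nonneg fun r _ => hnonneg r).1
    (hle.antisymm (Finset.sum_nonneg fun r _ => hnonneg r)) r (Finset.mem_univ r)
  simpa [sub_eq_zero, hq.injective.eq_iff] using hzero

theorem exists_perm_comp_eq_of_sum_le {q : α → R} (hq : StrictMono q)
    (hσ : (x ⊓ y) ∘ σ = x ⊓ y)
    (hle : ∑ r, q (x r) * q (y (σ r)) ≤ ∑ r, q (x r) * q (y r)) :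
    ∃ ρ : Equiv.Perm ι, x ∘ ρ = x ∧ y ∘ ρ = y ∘ σ := by
  classical
  suffices ∃ ρ : Equiv.Perm ι, (fun r => (x r, y r)) ∘ ρ = fun r => (x r, y (σ r)) by
    obtain ⟨ρ, hρ⟩ := this
    exact ⟨ρ, funext fun r => congrArg Prod.fst (congrFun hρ r),
      funext fun r => congrArg Prod.snd (congrFun hρ r)⟩
  refine exists_perm_comp_eq_of_card_fiber_eq fun ⟨a, b⟩ => ?_
  have hcard := sum_mul_comp_perm (R := ℤ) hσ (Pi.single a 1) (Pi.single b 1)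
  rw [Fintype.sum_eq_zero (fun r => (_ - _) * _), add_zero] at hcard
  · simpa [Pi.single_apply, ← ite_and, Finset.sum_boole, Fintype.card_subtype, eq_comm,
      and_comm] using hcard
  · intro r
    rcases eq_inf_or_comp_perm_eq_inf hq hσ hle r with h | h <;>
      simp only [h, sub_self, zero_mul, mul_zero]

end Exchange

section Columns

variable {d : ℕ} (μ : YoungDiagram) (h : μ.card = d)

/-- The row of the cell at a position of the reading word. -/
def rowOf (r : Fin d) : ℕ := (reading μ h r).1.1

/-- The column of the cell at a position of the reading word. -/
def colOf (r : Fin d) : ℕ := (reading μ h r).1.2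

variable {μ h}

theorem rowOf_lt_colLen (r : Fin d) : rowOf μ h r < μ.colLen (colOf μ h r) :=
  YoungDiagram.mem_iff_lt_colLen.1 ((YoungDiagram.mem_cells _).1 (reading μ h r).2)

theorem rowOf_lt {m : ℕ} (hm : μ.colLen 0 ≤ m) (r : Fin d) : rowOf μ h r < m :=
  (rowOf_lt_colLen r).trans_le ((μ.colLen_anti _ _ (Nat.zero_le _)).trans hm)

theorem exists_rowOf_eq_and_colOf_eq {a b : ℕ} (hab : a < μ.colLen b) :
    ∃ r, rowOf μ h r = a ∧ colOf μ h r = b := by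
  refine ⟨(reading μ h).symm
    ⟨(a, b), (YoungDiagram.mem_cells _).2 (YoungDiagram.mem_iff_lt_colLen.2 hab)⟩, ?_, ?_⟩ <;>
    simp [rowOf, colOf]

theorem eq_of_rowOf_eq_of_colOf_eq {r s : Fin d} (hrow : rowOf μ h r = rowOf μ h s)
    (hcol : colOf μ h r = colOf μ h s) : r = s :=
  (reading μ h).injective (Subtype.ext (Prod.ext hrow hcol))

theorem card_colOf_eq_le_colLen (b : ℕ) :
    (Finset.univ.filter fun r => colOf μ h r = b).card ≤ μ.colLen b := by
  rw [← Finset.card_range (μ.colLen b)]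
  refine Finset.card_le_card_of_injOn (rowOf μ h) (fun r hr => ?_) fun r hr s hs hrs => ?_
  · simp only [Finset.coe_filter, Finset.mem_univ, true_and, Set.mem_ofPred_eq] at hr
    simpa [← hr] using rowOf_lt_colLen r
  · simp only [Finset.coe_filter, Finset.mem_univ, true_and, Set.mem_ofPred_eq] at hr hs
    exact eq_of_rowOf_eq_of_colOf_eq hrs (hr.trans hs.symm)

theorem exists_perm_rowOf_le {s : Fin d → ℕ}
    (hs : ∀ x y, colOf μ h x = colOf μ h y → s x = s y → x = y) :
    ∃ π : Equiv.Perm (Fin d), (∀ r, colOf μ h (π r) = colOf μ h r) ∧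
      ∀ r, rowOf μ h (π r) ≤ s r := by
  -- Sort each column: the row of `π r` is the number of smaller values of `s` in the column of `r`.
  let below (r : Fin d) : Finset (Fin d) := {t | colOf μ h t = colOf μ h r ∧ s t < s r}
  have mem_below : ∀ t r, t ∈ below r ↔ colOf μ h t = colOf μ h r ∧ s t < s r := by simp [below]
  have hlt : ∀ r, (below r).card < μ.colLen (colOf μ h r) := by
    refine fun r => lt_of_lt_of_le (Finset.card_lt_card ?_) (card_colOf_eq_le_colLen (h := h) _)
    exact ⟨fun t ht => by grind, fun hsub => by grind [@hsub r (by simp)]⟩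
  have hle : ∀ r, (below r).card ≤ s r := by
    intro r
    rw [← Finset.card_range (s r)]
    refine Finset.card_le_card_of_injOn s (fun t ht => ?_) fun t ht t' ht' => hs t t' ?_
    · simpa using ((mem_below t r).1 ht).2
    · exact ((mem_below t r).1 ht).1.trans ((mem_below t' r).1 ht').1.symm
  have hmono : ∀ x y, colOf μ h x = colOf μ h y → s x < s y →
      (below x).card < (below y).card := fun x y hxy hsxy =>
    Finset.card_lt_card ⟨fun t ht => by grind, fun hsub => by grind⟩
  choose π hrow hcol using fun r => exists_rowOf_eq_and_colOf_eq (h := h) (hlt r)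
  have hinj : Function.Injective π := by
    intro x y hxy
    have hc : colOf μ h x = colOf μ h y := by rw [← hcol x, ← hcol y, hxy]
    have hr : (below x).card = (below y).card := by rw [← hrow x, ← hrow y, hxy]
    refine hs x y hc (le_antisymm ?_ ?_) <;> by_contra! hlt
    · exact (hmono y x hc.symm hlt).ne' hr
    · exact (hmono x y hc hlt).ne hr
  exact ⟨Equiv.ofBijective π (Finite.injective_iff_bijective.1 hinj), hcol,
    fun r => (hrow r).trans_le (hle r)⟩

theorem eq_rowOf_of_injOn_columns {c : Fin d → ℕ} (hc : c ≤ rowOf μ h)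
    (τ : Equiv.Perm (Fin d))
    (hτ : ∀ x y, colOf μ h x = colOf μ h y → c (τ x) = c (τ y) → x = y) :
    c = rowOf μ h ∧ ∃ π : Equiv.Perm (Fin d), (∀ r, colOf μ h (π r) = colOf μ h r) ∧
      c ∘ τ = rowOf μ h ∘ π := by
  obtain ⟨π, hcol, hπ⟩ := exists_perm_rowOf_le (s := c ∘ τ) hτ
  have hcτ : ∑ r, (c ∘ τ) r = ∑ r, c r := Equiv.sum_comp τ c
  have hrow : ∑ r, (rowOf μ h ∘ π) r = ∑ r, rowOf μ h r := Equiv.sum_comp π (rowOf μ h)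
  have hcrow : ∑ r, c r ≤ ∑ r, rowOf μ h r := Finset.sum_le_sum fun r _ => hc r
  have hπ' : ∑ r, (rowOf μ h ∘ π) r ≤ ∑ r, (c ∘ τ) r := Finset.sum_le_sum fun r _ => hπ r
  refine ⟨funext fun r => ?_, π, hcol, funext fun r => ?_⟩
  · exact (Finset.sum_eq_sum_iff_of_le fun r _ => hc r).1 (by omega) r (Finset.mem_univ r)
  · exact ((Finset.sum_eq_sum_iff_of_le fun r _ => hπ r).1 (hπ'.antisymm (by omega)) r
      (Finset.mem_univ r)).symm

end Columns

section WeightSpaces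

variable {k : Type*} [Field k] {N d : ℕ}

/-- The weight space of the tensor power to which `Z^c` belongs: it is spanned by the `Z^s` for the
rearrangements `s` of the word `c`. -/
def weightSpace (k : Type*) [Field k] {N d : ℕ} (c : Fin d → Fin N) :
    Submodule k (TensorPow k N d) :=
  Submodule.span k (Zw k N d '' Set.range fun τ : Equiv.Perm (Fin d) => c ∘ τ)

theorem mem_weightSpace_iff {c : Fin d → Fin N} {v : TensorPow k N d} :
    v ∈ weightSpace k c ↔
      ∀ s, (Zw k N d).repr v s ≠ 0 → ∃ τ : Equiv.Perm (Fin d), c ∘ τ = s := by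
  rw [weightSpace, Module.Basis.mem_span_image]
  exact forall_congr' fun s => imp_congr_left Finsupp.mem_support_iff

theorem weightSpace_comp_perm (c : Fin d → Fin N) (τ : Equiv.Perm (Fin d)) :
    weightSpace k (c ∘ τ) = weightSpace k c := by
  have : (fun σ : Equiv.Perm (Fin d) => (c ∘ τ) ∘ σ) =
      (fun σ : Equiv.Perm (Fin d) => c ∘ σ) ∘ Equiv.mulLeft τ := rfl
  rw [weightSpace, this, (Equiv.mulLeft τ).surjective.range_comp, weightSpace]

theorem repr_superPerm (p : Fin N → ZMod 2) (σ : Equiv.Perm (Fin d)) (v : TensorPow k N d)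
    (s : Fin d → Fin N) :
    (Zw k N d).repr (superPerm k p σ v) (s ∘ σ) =
      sgn k (invSum (p ∘ s) σ) * (Zw k N d).repr v s :=
  repr_apply_of_apply_basis_eq_smul _ σ.surjective.injective_comp_right (superPerm_Zw k p σ) v s

theorem superPerm_superPerm (p : Fin N → ZMod 2) (σ τ : Equiv.Perm (Fin d))
    (v : TensorPow k N d) :
    superPerm k p τ (superPerm k p σ v) = superPerm k p (σ * τ) v := by
  have : superPerm k p τ ∘ₗ superPerm k p σ = superPerm k p (σ * τ) := by
    refine (Zw k N d).ext fun i => ?_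
    rw [LinearMap.comp_apply, superPerm_Zw, map_smul, superPerm_Zw, superPerm_Zw, smul_smul,
      invSum_mul, sgn_add]
    rfl
  exact LinearMap.congr_fun this v

theorem superPerm_mem_weightSpace {c : Fin d → Fin N} {v : TensorPow k N d}
    (hv : v ∈ weightSpace k c) (p : Fin N → ZMod 2) (σ : Equiv.Perm (Fin d)) :
    superPerm k p σ v ∈ weightSpace k c := by
  refine (Submodule.span_le (p := (weightSpace k c).comap (superPerm k p σ))).2 ?_ hv
  rintro _ ⟨_, ⟨τ, rfl⟩, rfl⟩
  rw [SetLike.mem_coe, Submodule.mem_comap, superPerm_Zw]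
  exact Submodule.smul_mem _ _ (Submodule.subset_span ⟨_, ⟨τ * σ, rfl⟩, rfl⟩)

end WeightSpaces

section SchurAlgebra

variable {k : Type*} [Field k] {m n d : ℕ}

theorem superPerm_apply_comm (x : schurAlgebra k m n d) (σ : Equiv.Perm (Fin d))
    (v : TensorPow k (m + n) d) :
    superPerm k (parity m n) σ (x.1 v) = x.1 (superPerm k (parity m n) σ v) :=
  LinearMap.congr_fun ((Subalgebra.mem_centralizer_iff k).1 x.2 _ ⟨σ, rfl⟩) v

theorem repr_unPi (v : TensorPow k (m + n) d) (s : Fin d → Fin (m + n)) :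
    (Zw k (m + n) d).repr (unPi k m n d v) s =
      sgn k (ruleOfSigns (fun _ => 1) (parityPi m n ∘ s)) * (Zw k (m + n) d).repr v s :=
  repr_apply_of_apply_basis_eq_smul _ Function.injective_id (unPi_Zw k m n) v s

theorem unPi_mem_weightSpace {c : Fin d → Fin (m + n)} {v : TensorPow k (m + n) d}
    (hv : v ∈ weightSpace k c) : unPi k m n d v ∈ weightSpace k c :=
  mem_weightSpace_iff.2 fun s hs =>
    mem_weightSpace_iff.1 hv s (right_ne_zero_of_mul (repr_unPi v s ▸ hs))

theorem repr_dividedE (i j s : Fin d → Fin (m + n)) (v : TensorPow k (m + n) d) :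
    (Zw k (m + n) d).repr (dividedE k m n i j v) s =
      ∑ l, (Zw k (m + n) d).repr v l * (orbitCoeff k m n i j s l *
        sgn k (ruleOfSigns (parity m n ∘ s + parity m n ∘ l) (parity m n ∘ l))) := by
  classical
  conv_lhs => rw [← (Zw k (m + n) d).sum_repr v]
  simp only [map_sum, map_smul, dividedE_Zw]
  simp [Finsupp.single_apply]

theorem repr_dividedE_eq_zero {i j s : Fin d → Fin (m + n)} {v : TensorPow k (m + n) d}
    (h : ∀ τ : Equiv.Perm (Fin d), i ∘ τ = s → (Zw k (m + n) d).repr v (j ∘ τ) = 0) :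
    (Zw k (m + n) d).repr (dividedE k m n i j v) s = 0 := by
  rw [repr_dividedE]
  refine Finset.sum_eq_zero fun l _ => ?_
  by_cases hτ : ∃ τ : Equiv.Perm (Fin d), i ∘ τ = s ∧ j ∘ τ = l
  · obtain ⟨τ, hi, rfl⟩ := hτ
    rw [h τ hi, zero_mul]
  · rw [orbitCoeff, dif_neg hτ, zero_mul, mul_zero]

theorem dividedE_apply_mem_weightSpace (i j : Fin d → Fin (m + n)) (v : TensorPow k (m + n) d) :
    dividedE k m n i j v ∈ weightSpace k i :=
  mem_weightSpace_iff.2 fun _ hs => by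
    by_contra hτ
    exact hs (repr_dividedE_eq_zero fun τ hi => absurd ⟨τ, hi⟩ hτ)

theorem dividedE_apply_eq_zero {i j c : Fin d → Fin (m + n)} {v : TensorPow k (m + n) d}
    (hv : v ∈ weightSpace k c) (hj : ∀ τ : Equiv.Perm (Fin d), j ∘ τ ≠ c) :
    dividedE k m n i j v = 0 := by
  refine (Zw k (m + n) d).ext_elem fun s => ?_
  rw [map_zero, Finsupp.zero_apply]
  refine repr_dividedE_eq_zero fun τ _ => ?_
  by_contra hne
  obtain ⟨τ', hτ'⟩ := mem_weightSpace_iff.1 hv _ hne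
  exact hj (τ * τ'⁻¹) (funext fun r => by simpa using (congrFun hτ' (τ'⁻¹ r)).symm)

theorem dividedZ_mem_weightSpace {lam : YoungDiagram} (h : lam.card = d)
    (t : Fin d → Fin (m + n)) : dividedZ k m n lam h t ∈ weightSpace k t := by
  refine Submodule.sum_mem _ fun s _ => ?_
  split_ifs with hs
  · exact Submodule.smul_mem _ _ (Submodule.subset_span ⟨s, ⟨_, hs.choose_spec.2⟩, rfl⟩)
  · exact Submodule.zero_mem _

theorem repr_dividedZ_self_ne_zero {lam : YoungDiagram} (h : lam.card = d)
    (t : Fin d → Fin (m + n)) :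
    (Zw k (m + n) d).repr (dividedZ k m n lam h t) t ≠ 0 := by
  classical
  rw [dividedZ, map_sum, Finsupp.coe_finsetSum, Finset.sum_apply, Finset.sum_eq_single t]
  · rw [dif_pos ⟨1, fun _ => rfl, rfl⟩]
    simp [sgn_ne_zero]
  · intro s _ hs
    split_ifs <;> simp [Finsupp.single_eq_of_ne' hs]
  · simp

end SchurAlgebra

section ColumnAlternating

variable {k : Type*} [Field k] {m n d : ℕ} {μ : YoungDiagram} {h : μ.card = d}

/-- The tensors on which the permutations of positions within the columns of `μ` act by their
signs. They are the images of `Γ_Π^{μ'} M` in `M^{⊗d}`. -/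
def colAlternating (k : Type*) [Field k] (m n : ℕ) (μ : YoungDiagram) {d : ℕ} (h : μ.card = d) :
    Submodule k (TensorPow k (m + n) d) where
  carrier := {v | ∀ π : Equiv.Perm (Fin d), (∀ r, colOf μ h (π r) = colOf μ h r) →
    superPerm k (parity m n) π v = sgn k (invSum (fun _ => 1) π) • v}
  add_mem' ha hb π hπ := by rw [map_add, ha π hπ, hb π hπ, smul_add]
  zero_mem' π _ := by rw [map_zero, smul_zero]
  smul_mem' c v hv π hπ := by rw [map_smul, hv π hπ, smul_comm]

theorem apply_mem_colAlternating (x : schurAlgebra k m n d) {v : TensorPow k (m + n) d}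
    (hv : v ∈ colAlternating k m n μ h) : x.1 v ∈ colAlternating k m n μ h := by
  intro π hπ
  rw [superPerm_apply_comm, hv π hπ, map_smul]

theorem repr_comp_perm_eq_zero {v : TensorPow k (m + n) d} (hv : v ∈ colAlternating k m n μ h)
    {π : Equiv.Perm (Fin d)} (hπ : ∀ r, colOf μ h (π r) = colOf μ h r)
    {s : Fin d → Fin (m + n)} (hs : (Zw k (m + n) d).repr v s = 0) :
    (Zw k (m + n) d).repr v (s ∘ π) = 0 := by
  have hrepr := repr_superPerm (parity m n) π v s
  rw [hv π hπ, hs, mul_zero, map_smul, Finsupp.smul_apply, smul_eq_mul] at hrepr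
  exact (mul_eq_zero.1 hrepr).resolve_left (sgn_ne_zero k _)

theorem repr_eq_zero_of_apply_eq (hk : (2 : k) ≠ 0) {v : TensorPow k (m + n) d}
    (hv : v ∈ colAlternating k m n μ h) {s : Fin d → Fin (m + n)} {x y : Fin d} (hxy : x ≠ y)
    (hcol : colOf μ h x = colOf μ h y) (hs : s x = s y) (hp : parity m n (s x) = 0) :
    (Zw k (m + n) d).repr v s = 0 := by
  have hrepr := repr_superPerm (parity m n) (Equiv.swap x y) v s
  rw [hv _ (Equiv.apply_swap_eq_self hcol), invSum_swap hxy rfl,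
    invSum_swap hxy (congrArg (parity m n) hs), Function.comp_apply, hp,
    show s ∘ Equiv.swap x y = s from funext (Equiv.apply_swap_eq_self hs), map_smul,
    Finsupp.smul_apply, sgn_one, sgn_zero, smul_eq_mul] at hrepr
  have : (2 : k) * (Zw k (m + n) d).repr v s = 0 := by linear_combination -hrepr
  exact (mul_eq_zero.1 this).resolve_left hk

theorem rowOf_sigmaPerm (r : Fin d) :
    rowOf μ.transpose (card_transpose h) (sigmaPerm μ h r) = colOf μ h r := by
  simp [rowOf, colOf, sigmaPerm, swapCells]

theorem colOf_sigmaPerm (r : Fin d) :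
    colOf μ.transpose (card_transpose h) (sigmaPerm μ h r) = rowOf μ h r := by
  simp [rowOf, colOf, sigmaPerm, swapCells]

theorem superPerm_sigmaPerm_unPi_mem_colAlternating {w : TensorPow k (m + n) d}
    (hw : w ∈ gammaPi k m n μ.transpose (card_transpose h)) :
    superPerm k (parity m n) (sigmaPerm μ h) (unPi k m n d w) ∈ colAlternating k m n μ h := by
  intro π hπ
  obtain ⟨σ, hσ⟩ : ∃ σ, sigmaPerm μ h * π = σ * sigmaPerm μ h :=
    ⟨sigmaPerm μ h * π * (sigmaPerm μ h)⁻¹, by group⟩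
  have hσY : IsYoung μ.transpose (card_transpose h) σ := by
    intro r
    obtain ⟨r, rfl⟩ := (sigmaPerm μ h).surjective r
    change rowOf μ.transpose _ ((σ * sigmaPerm μ h) r) = rowOf μ.transpose _ (sigmaPerm μ h r)
    rw [← hσ, Equiv.Perm.mul_apply, rowOf_sigmaPerm, hπ, rowOf_sigmaPerm]
  have hsgn : sgn k (invSum (fun _ => 1) σ) = sgn k (invSum (fun _ => 1) π) := by
    have := congrArg (invSum fun _ => 1) hσ
    rw [invSum_mul, invSum_mul, add_comm] at this
    exact congrArg (sgn k) (add_right_cancel this).symm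
  have hu : superPerm k (parity m n) σ (unPi k m n d w) =
      sgn k (invSum (fun _ => 1) σ) • unPi k m n d w := by
    conv_rhs => rw [← hw σ hσY, unPi_superPerm, smul_smul, sgn_mul_self, one_smul]
  rw [superPerm_superPerm, hσ, ← superPerm_superPerm, hu, map_smul, hsgn]

/-- The word whose letter at each position of the reading word of `μ` is the row of that
position, that is, the reading word of the tableau `(i, j) ↦ i`. -/
def rowWord (m n : ℕ) (μ : YoungDiagram) {d : ℕ} (h : μ.card = d) (hm : μ.colLen 0 ≤ m) :
    Fin d → Fin (m + n) :=
  fun r => ⟨rowOf μ h r, (rowOf_lt hm r).trans_le (Nat.le_add_right m n)⟩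

variable {hm : μ.colLen 0 ≤ m}

theorem parity_eq_zero_of_le_rowWord {a : Fin (m + n)} {r : Fin d}
    (ha : a ≤ rowWord m n μ h hm r) : parity m n a = 0 :=
  if_pos ((Fin.le_def.1 ha).trans_lt (rowOf_lt hm r))

theorem eq_rowWord_of_mem_weightSpace (hk : (2 : k) ≠ 0) {v : TensorPow k (m + n) d}
    (hv : v ∈ colAlternating k m n μ h) {c : Fin d → Fin (m + n)}
    (hc : c ≤ rowWord m n μ h hm) (hvc : v ∈ weightSpace k c) (hv0 : v ≠ 0) :
    c = rowWord m n μ h hm ∧ (Zw k (m + n) d).repr v c ≠ 0 := by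
  obtain ⟨s, hs⟩ := Finsupp.ne_iff.1 ((Zw k (m + n) d).repr.map_ne_zero_iff.2 hv0)
  obtain ⟨τ, rfl⟩ := mem_weightSpace_iff.1 hvc s hs
  obtain ⟨hrow, π, hπ, hτ⟩ := eq_rowOf_of_injOn_columns (h := h) (c := Fin.val ∘ c) hc τ
    fun x y hcol hxy => by
      by_contra hne
      exact hs (repr_eq_zero_of_apply_eq hk hv hne hcol (Fin.ext hxy)
        (parity_eq_zero_of_le_rowWord (hc (τ x))))
  have hcτ : c ∘ τ = c ∘ π := by
    funext r
    exact Fin.ext ((congrFun hτ r).trans (congrFun hrow (π r)).symm)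
  exact ⟨funext fun r => Fin.ext (congrFun hrow r),
    fun h0 => hs (hcτ ▸ repr_comp_perm_eq_zero hv hπ h0)⟩

end ColumnAlternating

section Straightening

variable {k : Type*} [Field k] {m n d : ℕ} {μ : YoungDiagram} {h : μ.card = d}
  {hm : μ.colLen 0 ≤ m}

theorem isYoung_iff_rowWord_comp_eq {ρ : Equiv.Perm (Fin d)} :
    IsYoung μ h ρ ↔ rowWord m n μ h hm ∘ ρ = rowWord m n μ h hm := by
  simp only [IsYoung, funext_iff, Fin.ext_iff]
  rfl

theorem IsYoung.mul {σ τ : Equiv.Perm (Fin d)} (hσ : IsYoung μ h σ) (hτ : IsYoung μ h τ) :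
    IsYoung μ h (σ * τ) := fun r => (hσ (τ r)).trans (hτ r)

theorem IsYoung.inv {σ : Equiv.Perm (Fin d)} (hσ : IsYoung μ h σ) : IsYoung μ h σ⁻¹ :=
  fun r => by simpa using (hσ (σ⁻¹ r)).symm

theorem superPerm_sub_mem_symKer {ρ : Equiv.Perm (Fin d)} (hρ : IsYoung μ h ρ)
    (v : TensorPow k (m + n) d) : superPerm k (parity m n) ρ v - v ∈ symKer k m n μ h :=
  Submodule.subset_span ⟨ρ, v, hρ, rfl⟩

/-- A tensor is reduced if no nonzero element of the kernel of `M^{⊗d} → S^μ M` involves only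
basis tensors that occur in it. -/
def IsReduced (k : Type*) [Field k] (m n : ℕ) (μ : YoungDiagram) {d : ℕ} (h : μ.card = d)
    (w : TensorPow k (m + n) d) : Prop :=
  ∀ z ∈ symKer k m n μ h,
    ((Zw k (m + n) d).repr z).support ⊆ ((Zw k (m + n) d).repr w).support → z = 0

theorem exists_isReduced (v : TensorPow k (m + n) d) :
    ∃ w, v - w ∈ symKer k m n μ h ∧ IsReduced k m n μ h w :=
  exists_sub_mem_forall_support_subset (Zw k (m + n) d)
    ((symKer k m n μ h).restrictScalars k) v

theorem IsReduced.isStrict (hk : (2 : k) ≠ 0) {w : TensorPow k (m + n) d}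
    (hw : IsReduced k m n μ h w) {l : Fin d → Fin (m + n)}
    (hl : (Zw k (m + n) d).repr w l ≠ 0) : IsStrict m n (rowWord m n μ h hm) l := by
  intro x y hxy hx hy hrl
  obtain ⟨hrow, hlxy⟩ := Prod.mk.inj hrl
  rw [parity_eq_zero_of_le_rowWord le_rfl, zero_add] at hx
  have hswap : superPerm k (parity m n) (Equiv.swap x y) (Zw k (m + n) d l) - Zw k (m + n) d l =
      (-2 : k) • Zw k (m + n) d l := by
    rw [superPerm_Zw, invSum_swap hxy (congrArg (parity m n) hlxy), Function.comp_apply, hx,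
      sgn_one, show l ∘ Equiv.swap x y = l from funext (Equiv.apply_swap_eq_self hlxy)]
    module
  have hzero := hw _ (superPerm_sub_mem_symKer (isYoung_iff_rowWord_comp_eq.2
    (funext (Equiv.apply_swap_eq_self hrow))) (Zw k (m + n) d l)) ?_
  · exact smul_ne_zero (neg_ne_zero.2 hk) ((Zw k (m + n) d).ne_zero l) (hswap ▸ hzero)
  · rw [hswap, map_smul, Module.Basis.repr_self]
    exact Finsupp.support_smul.trans (Finsupp.support_single_subset.trans (by simpa using hl))

theorem IsReduced.comp_perm_eq {w : TensorPow k (m + n) d} (hw : IsReduced k m n μ h w)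
    {l : Fin d → Fin (m + n)} (hl : (Zw k (m + n) d).repr w l ≠ 0) {ρ : Equiv.Perm (Fin d)}
    (hρ : IsYoung μ h ρ) (hlρ : (Zw k (m + n) d).repr w (l ∘ ρ) ≠ 0) : l ∘ ρ = l := by
  classical
  by_contra hne
  have hzero := hw _ (superPerm_sub_mem_symKer hρ (Zw k (m + n) d l)) ?_
  · have hcoord := congrArg (fun z => (Zw k (m + n) d).repr z l) hzero
    simp [superPerm_Zw, Finsupp.single_eq_of_ne' hne] at hcoord
  · intro s hs
    rw [superPerm_Zw, map_sub, map_smul, Module.Basis.repr_self, Module.Basis.repr_self] at hs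
    rcases Finset.mem_union.1 (Finsupp.support_sub hs) with hs | hs
    · have := Finsupp.support_single_subset (Finsupp.support_smul hs)
      simp_all
    · have := Finsupp.support_single_subset hs
      simp_all

open Classical in
/-- The functional that takes the value `1` at the `Z^s` for the words `s` that arise from `i` by
permutations within the rows. For words of even letters it descends to the coinvariants. -/
def rowCoeff (k : Type*) [Field k] (m n : ℕ) (μ : YoungDiagram) {d : ℕ} (h : μ.card = d)
    (i : Fin d → Fin (m + n)) : TensorPow k (m + n) d →ₗ[k] k :=
  (Zw k (m + n) d).constr k fun s => if ∃ ρ, IsYoung μ h ρ ∧ i ∘ ρ = s then 1 else 0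

open Classical in
theorem rowCoeff_Zw (i s : Fin d → Fin (m + n)) : rowCoeff k m n μ h i (Zw k (m + n) d s) =
    if ∃ ρ, IsYoung μ h ρ ∧ i ∘ ρ = s then 1 else 0 := by
  rw [rowCoeff, Module.Basis.constr_basis]

theorem rowCoeff_eq_zero_of_mem_symKer {i : Fin d → Fin (m + n)} (hi : parity m n ∘ i = 0)
    {v : TensorPow k (m + n) d} (hv : v ∈ symKer k m n μ h) : rowCoeff k m n μ h i v = 0 := by
  classical
  refine (Submodule.span_le (p := LinearMap.ker (rowCoeff k m n μ h i))).2 ?_ hv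
  rintro _ ⟨σ, w, hσ, rfl⟩
  have hcomp : rowCoeff k m n μ h i ∘ₗ superPerm k (parity m n) σ = rowCoeff k m n μ h i := by
    refine (Zw k (m + n) d).ext fun s => ?_
    rw [LinearMap.comp_apply, superPerm_Zw, map_smul, rowCoeff_Zw, rowCoeff_Zw]
    by_cases hs : ∃ ρ, IsYoung μ h ρ ∧ i ∘ ρ = s
    · obtain ⟨ρ, hρ, rfl⟩ := hs
      rw [if_pos ⟨ρ * σ, hρ.mul hσ, rfl⟩, if_pos ⟨ρ, hρ, rfl⟩, ← Function.comp_assoc, hi,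
        Pi.zero_comp, invSum_zero, sgn_zero, one_smul]
    · rw [if_neg hs, if_neg, smul_zero]
      rintro ⟨ρ, hρ, hiρ⟩
      exact hs ⟨ρ * σ⁻¹, hρ.mul hσ.inv, funext fun r => by simpa using congrFun hiρ (σ⁻¹ r)⟩
  rw [SetLike.mem_coe, LinearMap.mem_ker, map_sub, sub_eq_zero]
  exact LinearMap.congr_fun hcomp w

theorem rowCoeff_rowWord (v : TensorPow k (m + n) d) :
    rowCoeff k m n μ h (rowWord m n μ h hm) v =
      (Zw k (m + n) d).repr v (rowWord m n μ h hm) := by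
  classical
  have : rowCoeff k m n μ h (rowWord m n μ h hm) =
      (Zw k (m + n) d).coord (rowWord m n μ h hm) := by
    refine (Zw k (m + n) d).ext fun s => ?_
    rw [rowCoeff_Zw, Module.Basis.coord_apply, Module.Basis.repr_self, Finsupp.single_apply]
    refine if_congr ⟨?_, fun hs => ⟨1, fun _ => rfl, hs.symm⟩⟩ rfl rfl
    rintro ⟨ρ, hρ, rfl⟩
    exact isYoung_iff_rowWord_comp_eq.1 hρ
  rw [this, Module.Basis.coord_apply]

theorem exists_of_rowCoeff_dividedE_Zw_ne_zero {i j l : Fin d → Fin (m + n)}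
    (hne : rowCoeff k m n μ h i (dividedE k m n i j (Zw k (m + n) d l)) ≠ 0) :
    ∃ τ ρ : Equiv.Perm (Fin d), IsYoung μ h ρ ∧ i ∘ τ = i ∘ ρ ∧ j ∘ τ = l := by
  classical
  rw [dividedE_Zw, map_sum] at hne
  obtain ⟨s, -, hs⟩ := Finset.exists_ne_zero_of_sum_ne_zero hne
  rw [map_smul, rowCoeff_Zw, smul_eq_mul] at hs
  obtain ⟨ρ, hρ, rfl⟩ := (ite_ne_right_iff.1 (right_ne_zero_of_mul hs)).1
  obtain ⟨⟨τ, hi, hj⟩, -⟩ := dite_ne_right_iff.1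
    (left_ne_zero_of_mul (left_ne_zero_of_mul hs))
  exact ⟨τ, ρ, hρ, hi, hj⟩

theorem rowCoeff_dividedE_Zw_self_ne_zero {i j : Fin d → Fin (m + n)}
    (hij : ∀ τ ρ : Equiv.Perm (Fin d), IsYoung μ h ρ → j ∘ τ = j → i ∘ τ = i ∘ ρ → i ∘ τ = i) :
    rowCoeff k m n μ h i (dividedE k m n i j (Zw k (m + n) d j)) ≠ 0 := by
  classical
  rw [dividedE_Zw, map_sum, Finset.sum_eq_single i]
  · rw [map_smul, rowCoeff_Zw, if_pos ⟨1, fun _ => rfl, rfl⟩, smul_eq_mul, mul_one, orbitCoeff,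
      dif_pos ⟨1, rfl, rfl⟩]
    exact mul_ne_zero (sgn_ne_zero k _) (sgn_ne_zero k _)
  · intro s _ hs
    by_contra hne
    rw [map_smul, rowCoeff_Zw, smul_eq_mul] at hne
    obtain ⟨ρ, hρ, rfl⟩ := (ite_ne_right_iff.1 (right_ne_zero_of_mul hne)).1
    obtain ⟨⟨τ, hi, hj⟩, -⟩ := dite_ne_right_iff.1
      (left_ne_zero_of_mul (left_ne_zero_of_mul hne))
    exact hs (hi.symm.trans (hij τ ρ hρ hj hi))
  · simp

theorem IsStrict.rowWord_inf {j : Fin d → Fin (m + n)}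
    (hj : IsStrict m n (rowWord m n μ h hm) j) : IsStrict m n (rowWord m n μ h hm ⊓ j) j := by
  have hinf : ∀ r, parity m n ((rowWord m n μ h hm ⊓ j) r) + parity m n (j r) = 1 →
      (rowWord m n μ h hm ⊓ j) r = rowWord m n μ h hm r := by
    intro r hr
    rcases le_total (rowWord m n μ h hm r) (j r) with hle | hle
    · exact inf_eq_left.2 hle
    · rw [show (rowWord m n μ h hm ⊓ j) r = j r from inf_eq_right.2 hle,
        CharTwo.add_self_eq_zero] at hr
      exact absurd hr zero_ne_one
  intro a b hab ha hb heq
  rw [hinf a ha, hinf b hb] at heq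
  exact hj a b hab (hinf a ha ▸ ha) (hinf b hb ▸ hb) heq

theorem eq_of_rowCoeff_dividedE_Zw_ne_zero {w : TensorPow k (m + n) d}
    (hw : IsReduced k m n μ h w) {q : Fin (m + n) → ℤ} (hq : StrictMono q)
    {j l : Fin d → Fin (m + n)} (hj : (Zw k (m + n) d).repr w j ≠ 0)
    (hl : (Zw k (m + n) d).repr w l ≠ 0)
    (hle : ∑ r, q (rowWord m n μ h hm r) * q (l r) ≤ ∑ r, q (rowWord m n μ h hm r) * q (j r))
    (hne : rowCoeff k m n μ h (rowWord m n μ h hm ⊓ j)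
      (dividedE k m n (rowWord m n μ h hm ⊓ j) j (Zw k (m + n) d l)) ≠ 0) : l = j := by
  obtain ⟨τ, ρ, hρ, hi, rfl⟩ := exists_of_rowCoeff_dividedE_Zw_ne_zero hne
  set c := rowWord m n μ h hm
  have hcρ : c ∘ ρ = c := isYoung_iff_rowWord_comp_eq.1 hρ
  have hσ : (c ⊓ j) ∘ (τ * ρ⁻¹ : Equiv.Perm (Fin d)) = c ⊓ j :=
    funext fun r => by simpa using congrFun hi (ρ⁻¹ r)
  have hsum : ∑ r, q (c r) * q (j ((τ * ρ⁻¹) r)) = ∑ r, q (c r) * q ((j ∘ τ) r) := by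
    rw [← Equiv.sum_comp ρ]
    exact Finset.sum_congr rfl fun r _ => by simp [show c (ρ r) = c r from congrFun hcρ r]
  obtain ⟨ρ', hcρ', hjρ'⟩ := exists_perm_comp_eq_of_sum_le hq hσ (hsum.trans_le hle)
  have hjτ : j ∘ (ρ' * ρ : Equiv.Perm (Fin d)) = j ∘ τ :=
    funext fun r => by simpa using congrFun hjρ' (ρ r)
  rw [← hjτ] at hl ⊢
  exact hw.comp_perm_eq hj ((isYoung_iff_rowWord_comp_eq.2 hcρ').mul hρ) hl

theorem rowCoeff_dividedE_ne_zero {w : TensorPow k (m + n) d}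
    (hw : IsReduced k m n μ h w) {q : Fin (m + n) → ℤ} (hq : StrictMono q)
    {j : Fin d → Fin (m + n)} (hj : (Zw k (m + n) d).repr w j ≠ 0)
    (hmax : ∀ l, (Zw k (m + n) d).repr w l ≠ 0 →
      ∑ r, q (rowWord m n μ h hm r) * q (l r) ≤ ∑ r, q (rowWord m n μ h hm r) * q (j r)) :
    rowCoeff k m n μ h (rowWord m n μ h hm ⊓ j)
      (dividedE k m n (rowWord m n μ h hm ⊓ j) j w) ≠ 0 := by
  rw [← (Zw k (m + n) d).sum_repr w]
  simp only [map_sum, map_smul]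
  rw [Finset.sum_eq_single j]
  · exact mul_ne_zero hj (rowCoeff_dividedE_Zw_self_ne_zero fun τ ρ hρ =>
      inf_comp_perm_eq (isYoung_iff_rowWord_comp_eq.1 hρ))
  · intro l _ hlj
    by_contra hne
    have hl := left_ne_zero_of_mul hne
    exact hlj (eq_of_rowCoeff_dividedE_Zw_ne_zero hw hq hj hl (hmax l hl)
      (right_ne_zero_of_mul hne))
  · exact fun hj' => absurd (Finset.mem_univ j) hj'

theorem exists_le_dividedE_ne_zero_of_notMem_symKer (hk : (2 : k) ≠ 0)
    {v : TensorPow k (m + n) d} (hv : v ∈ colAlternating k m n μ h)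
    (hv0 : v ∉ symKer k m n μ h) :
    ∃ j, IsStrict m n (rowWord m n μ h hm) j ∧ rowWord m n μ h hm ≤ j ∧
      dividedE k m n (rowWord m n μ h hm) j v ≠ 0 := by
  obtain ⟨w, hvw, hw⟩ := exists_isReduced (μ := μ) (h := h) v
  have hw0 : w ≠ 0 := by
    rintro rfl
    exact hv0 (by simpa using hvw)
  set c := rowWord m n μ h hm
  let q : Fin (m + n) → ℤ := fun a => (a : ℕ)
  have hq : StrictMono q := fun a b hab => Int.ofNat_lt.2 hab
  obtain ⟨j, hj, hmax⟩ := Finset.exists_max_image ((Zw k (m + n) d).repr w).support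
    (fun l => ∑ r, q (c r) * q (l r))
    (Finsupp.support_nonempty_iff.2 ((Zw k (m + n) d).repr.map_ne_zero_iff.2 hw0))
  simp only [Finsupp.mem_support_iff] at hj hmax
  have hstrict : IsStrict m n c j := hw.isStrict hk hj
  have hne : dividedE k m n (c ⊓ j) j v ≠ 0 := by
    intro hzero
    have hker : dividedE k m n (c ⊓ j) j (v - w) ∈ symKer k m n μ h :=
      (symKer k m n μ h).smul_mem (schurE k m n (c ⊓ j) j hstrict.rowWord_inf) hvw
    rw [map_sub, hzero, zero_sub, neg_mem_iff] at hker
    exact rowCoeff_dividedE_ne_zero hw hq hj hmax (rowCoeff_eq_zero_of_mem_symKer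
      (funext fun r => parity_eq_zero_of_le_rowWord inf_le_left) hker)
  have hinf : c ⊓ j = c := (eq_rowWord_of_mem_weightSpace hk
    (apply_mem_colAlternating (schurE k m n (c ⊓ j) j hstrict.rowWord_inf) hv) inf_le_left
    (dividedE_apply_mem_weightSpace _ j v) hne).1
  exact ⟨j, hstrict, inf_eq_left.1 hinf, hinf ▸ hne⟩

end Straightening

section HighestWeight

variable {k : Type*} [Field k] {m n d : ℕ} {μ : YoungDiagram} {h : μ.card = d}
  {hm : μ.colLen 0 ≤ m}

theorem exists_eq_smul_of_mem_weightSpace_rowWord (hk : (2 : k) ≠ 0)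
    {v w : TensorPow k (m + n) d} (hv : v ∈ colAlternating k m n μ h)
    (hvc : v ∈ weightSpace k (rowWord m n μ h hm)) (hw : w ∈ colAlternating k m n μ h)
    (hwc : w ∈ weightSpace k (rowWord m n μ h hm)) (hw0 : w ≠ 0) : ∃ a : k, v = a • w := by
  have hcoord := (eq_rowWord_of_mem_weightSpace hk hw le_rfl hwc hw0).2
  refine ⟨(Zw k (m + n) d).repr v (rowWord m n μ h hm) /
    (Zw k (m + n) d).repr w (rowWord m n μ h hm), sub_eq_zero.1 ?_⟩
  by_contra hne
  refine (eq_rowWord_of_mem_weightSpace hk (sub_mem hv (Submodule.smul_mem _ _ hw)) le_rfl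
    (sub_mem hvc (Submodule.smul_mem _ _ hwc)) hne).2 ?_
  rw [map_sub, map_smul, Finsupp.sub_apply, Finsupp.smul_apply, smul_eq_mul,
    div_mul_cancel₀ _ hcoord, sub_self]

theorem notMem_symKer_of_mem_weightSpace_rowWord (hk : (2 : k) ≠ 0)
    {w : TensorPow k (m + n) d} (hw : w ∈ colAlternating k m n μ h)
    (hwc : w ∈ weightSpace k (rowWord m n μ h hm)) (hw0 : w ≠ 0) : w ∉ symKer k m n μ h := by
  intro hker
  refine (eq_rowWord_of_mem_weightSpace hk hw le_rfl hwc hw0).2 ?_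
  rw [← rowCoeff_rowWord]
  exact rowCoeff_eq_zero_of_mem_symKer (funext fun r => parity_eq_zero_of_le_rowWord le_rfl) hker

theorem dividedE_apply_eq_zero_of_lt (hk : (2 : k) ≠ 0)
    {w : TensorPow k (m + n) d} (hw : w ∈ colAlternating k m n μ h)
    (hwc : w ∈ weightSpace k (rowWord m n μ h hm)) {i j : Fin d → Fin (m + n)}
    (hij : IsStrict m n i j) (hlt : i < j) : dividedE k m n i j w = 0 := by
  by_cases hj : ∃ τ : Equiv.Perm (Fin d), j ∘ τ = rowWord m n μ h hm
  · obtain ⟨τ, hτ⟩ := hj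
    by_contra hne
    have hiτ : i ∘ τ = rowWord m n μ h hm := (eq_rowWord_of_mem_weightSpace hk
      (apply_mem_colAlternating (schurE k m n i j hij) hw) (hτ ▸ fun r => hlt.le (τ r))
      (weightSpace_comp_perm (k := k) i τ ▸ dividedE_apply_mem_weightSpace i j w) hne).1
    exact hlt.ne (τ.surjective.injective_comp_right (hiτ.trans hτ.symm))
  · exact dividedE_apply_eq_zero hwc (not_exists.1 hj)

theorem exists_sub_smul_mem_symKer_or_exists_dividedE_ne_zero (hk : (2 : k) ≠ 0)
    {v w : TensorPow k (m + n) d} (hv : v ∈ colAlternating k m n μ h)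
    (hw : w ∈ colAlternating k m n μ h) (hwc : w ∈ weightSpace k (rowWord m n μ h hm))
    (hw0 : w ≠ 0) :
    (∃ a : k, v - a • w ∈ symKer k m n μ h) ∨
      ∃ j, IsStrict m n (rowWord m n μ h hm) j ∧ rowWord m n μ h hm < j ∧
        dividedE k m n (rowWord m n μ h hm) j v ≠ 0 := by
  set c := rowWord m n μ h hm
  have hcoord := (eq_rowWord_of_mem_weightSpace hk hw le_rfl hwc hw0).2
  set a := (Zw k (m + n) d).repr v c / (Zw k (m + n) d).repr w c with ha
  refine or_iff_not_imp_left.2 fun hker => ?_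
  obtain ⟨j, hj, hle, hne⟩ := exists_le_dividedE_ne_zero_of_notMem_symKer (hm := hm) hk
    (sub_mem hv (Submodule.smul_mem _ a hw)) (not_exists.1 hker a)
  have hlt : c < j := by
    refine hle.lt_of_ne fun hcj => ?_
    subst hcj
    refine (eq_rowWord_of_mem_weightSpace hk (apply_mem_colAlternating (schurE k m n c c hj)
      (sub_mem hv (Submodule.smul_mem _ a hw))) le_rfl
      (dividedE_apply_mem_weightSpace c c _) hne).2 (repr_dividedE_eq_zero fun τ hτ => ?_)
    rw [hτ, map_sub, map_smul, Finsupp.sub_apply, Finsupp.smul_apply, smul_eq_mul, ha,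
      div_mul_cancel₀ _ hcoord, sub_self]
  refine ⟨j, hj, hlt, ?_⟩
  rwa [map_sub, map_smul, dividedE_apply_eq_zero_of_lt hk hw hwc hj hlt, smul_zero,
    sub_zero] at hne

end HighestWeight

-- A shortcut: the search through the general instances for submodules and quotients is slow.
instance instSMulSchurSupermodule (k : Type*) [Field k] (m n : ℕ) (μ : YoungDiagram) {d : ℕ}
    (h : μ.card = d) : SMul (schurAlgebra k m n d) (schurSupermodule k m n μ h) :=
  Submodule.smul _

section CanonicalElement

variable {k : Type*} [Field k] {m n d : ℕ} {lam : YoungDiagram} {hd : lam.card = d}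
  {hl : lam.transpose.colLen 0 ≤ m}

/-- The tensor in `M^{⊗d}` whose image in the coinvariants is the canonical element. -/
def canonicalTensor (k : Type*) [Field k] (m n : ℕ) (lam : YoungDiagram) {d : ℕ}
    (hd : lam.card = d) (hl : lam.transpose.colLen 0 ≤ m) : TensorPow k (m + n) d :=
  superPerm k (parity m n) (sigmaPerm lam.transpose (card_transpose hd))
    (unPi k m n d (dividedZ k m n lam hd (canonicalWord m n lam hd hl)))

theorem canonicalTensor_mem_colAlternating : canonicalTensor k m n lam hd hl ∈
    colAlternating k m n lam.transpose (card_transpose hd) :=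
  superPerm_sigmaPerm_unPi_mem_colAlternating (canonicalWord_mem k m n lam hd hl)

theorem canonicalWord_comp_sigmaPerm :
    canonicalWord m n lam hd hl ∘ sigmaPerm lam.transpose (card_transpose hd) =
      rowWord m n lam.transpose (card_transpose hd) hl := by
  have hcol : ∀ (ν : YoungDiagram) (hν : ν.card = d), ν = lam → colOf ν hν = colOf lam hd := by
    rintro ν hν rfl
    rfl
  funext r
  refine Fin.ext ?_
  change colOf lam hd _ = rowOf lam.transpose (card_transpose hd) r
  rw [← colOf_sigmaPerm, hcol _ _ lam.transpose_transpose]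

theorem canonicalTensor_mem_weightSpace : canonicalTensor k m n lam hd hl ∈
    weightSpace k (rowWord m n lam.transpose (card_transpose hd) hl) := by
  rw [← canonicalWord_comp_sigmaPerm, weightSpace_comp_perm]
  exact superPerm_mem_weightSpace (unPi_mem_weightSpace (dividedZ_mem_weightSpace hd _)) _ _

theorem canonicalTensor_ne_zero : canonicalTensor k m n lam hd hl ≠ 0 := by
  intro hzero
  have hrepr := repr_superPerm (parity m n) (sigmaPerm lam.transpose (card_transpose hd))
    (unPi k m n d (dividedZ k m n lam hd (canonicalWord m n lam hd hl)))
    (canonicalWord m n lam hd hl)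
  rw [← canonicalTensor, hzero, map_zero, Finsupp.zero_apply, repr_unPi] at hrepr
  exact mul_ne_zero (sgn_ne_zero k _) (mul_ne_zero (sgn_ne_zero k _)
    (repr_dividedZ_self_ne_zero hd _)) hrepr.symm

theorem canonicalElement_val : (canonicalElement k m n lam hd hl).1 =
    (symKer k m n lam.transpose (card_transpose hd)).mkQ (canonicalTensor k m n lam hd hl) :=
  rfl

theorem exists_mkQ_eq {μ : YoungDiagram} {h : μ.card = d} (v : schurSupermodule k m n μ h) :
    ∃ w ∈ colAlternating k m n μ h, (symKer k m n μ h).mkQ w = v := by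
  obtain ⟨_, w, rfl⟩ := v
  exact ⟨_, superPerm_sigmaPerm_unPi_mem_colAlternating w.2, rfl⟩

theorem lt_of_forall_toLex_comp_perm_lt {α : Type*} [LinearOrder α] {i j : Fin d → α}
    (hij : ∀ σ : Equiv.Perm (Fin d), toLex (i ∘ σ) < toLex (j ∘ σ)) : i < j := by
  refine lt_of_le_of_ne (fun r => ?_) fun heq => (hij 1).ne (by rw [heq])
  have : NeZero d := ⟨r.pos.ne'⟩
  simpa using Pi.apply_le_of_toLex (hij (Equiv.swap r 0)).le (i := 0) fun s hs =>
    absurd hs s.not_lt_zero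

theorem schurE_mem_upperN {i j : Fin d → Fin (m + n)} (hij : IsStrict m n i j) (hlt : i < j) :
    schurE k m n i j hij ∈ upperN k m n d := by
  refine Submodule.subset_span ⟨i, j, hij, fun σ => Pi.toLex_strictMono ?_, rfl⟩
  exact lt_of_le_of_ne (fun r => hlt.le (σ r))
    (σ.surjective.injective_comp_right.ne hlt.ne)

theorem canonicalElement_ne_zero (hk : (2 : k) ≠ 0) : canonicalElement k m n lam hd hl ≠ 0 := by
  intro hzero
  have hmk : (symKer k m n lam.transpose (card_transpose hd)).mkQ
      (canonicalTensor k m n lam hd hl) = 0 := congrArg Subtype.val hzero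
  exact notMem_symKer_of_mem_weightSpace_rowWord hk canonicalTensor_mem_colAlternating
    canonicalTensor_mem_weightSpace canonicalTensor_ne_zero
    ((Submodule.Quotient.mk_eq_zero _).1 hmk)

theorem smul_canonicalElement_eq_zero (hk : (2 : k) ≠ 0) {x : schurAlgebra k m n d}
    (hx : x ∈ upperN k m n d) : x • canonicalElement k m n lam hd hl = 0 := by
  refine smul_eq_zero_of_mem_span (canonicalElement k m n lam hd hl) ?_ hx
  rintro _ ⟨i, j, hij, hlt, rfl⟩
  refine Subtype.ext ?_
  change (symKer k m n lam.transpose (card_transpose hd)).mkQ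
    (dividedE k m n i j (canonicalTensor k m n lam hd hl)) = 0
  rw [dividedE_apply_eq_zero_of_lt hk canonicalTensor_mem_colAlternating
    canonicalTensor_mem_weightSpace hij (lt_of_forall_toLex_comp_perm_lt hlt), map_zero]

theorem exists_smul_eq_canonicalElement (hk : (2 : k) ≠ 0)
    {v : schurSupermodule k m n lam.transpose (card_transpose hd)}
    (hv : v ∉ Submodule.span k {canonicalElement k m n lam hd hl}) :
    ∃ x ∈ upperN k m n d, x • v = canonicalElement k m n lam hd hl := by
  set K := symKer k m n lam.transpose (card_transpose hd)
  set w₀ := canonicalTensor k m n lam hd hl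
  obtain ⟨w, hw, hwv⟩ := exists_mkQ_eq v
  rcases exists_sub_smul_mem_symKer_or_exists_dividedE_ne_zero hk hw
    canonicalTensor_mem_colAlternating canonicalTensor_mem_weightSpace (hm := hl)
    canonicalTensor_ne_zero with ⟨a, ha⟩ | ⟨j, hj, hlt, hne⟩
  · refine absurd (Submodule.mem_span_singleton.2 ⟨a, Subtype.ext ?_⟩) hv
    change K.mkQ (a • w₀) = v
    rw [← hwv]
    exact ((Submodule.Quotient.eq K).2 ha).symm
  · set x := schurE k m n _ j hj
    obtain ⟨a, ha⟩ := exists_eq_smul_of_mem_weightSpace_rowWord hk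
      canonicalTensor_mem_colAlternating canonicalTensor_mem_weightSpace
      (apply_mem_colAlternating x hw) (dividedE_apply_mem_weightSpace _ j w) hne
    refine ⟨a • x, Submodule.smul_mem _ a (schurE_mem_upperN hj hlt), Subtype.ext ?_⟩
    rw [canonicalElement_val]
    change (a • x) • (v : SymPow k m n lam.transpose (card_transpose hd)) = K.mkQ w₀
    rw [← hwv, ← map_smul]
    exact congrArg K.mkQ ha.symm

end CanonicalElement

end SchurSuper

end

theorem mainTheorem4 {k : Type*} [Field k] (hk : (2 : k) ≠ 0) (m n d : ℕ) (lam : YoungDiagram)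
    (hd : lam.card = d) (hlam : lam.transpose.colLen 0 ≤ m) :
    (∀ W : Submodule k
        (SchurSuper.schurSupermodule k m n lam.transpose (SchurSuper.card_transpose hd)),
      SchurSuper.IsNSubmodule (SchurSuper.upperN k m n d) W → W ≠ ⊥ →
        SchurSuper.canonicalElement k m n lam hd hlam ∈ W) ∧
    SchurSuper.nInvariants
        (V := SchurSuper.schurSupermodule k m n lam.transpose (SchurSuper.card_transpose hd))
        (SchurSuper.upperN k m n d) =
      Submodule.span k {SchurSuper.canonicalElement k m n lam hd hlam} ∧
    SchurSuper.IsNIndecomposable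
      (V := SchurSuper.schurSupermodule k m n lam.transpose (SchurSuper.card_transpose hd))
      (SchurSuper.upperN k m n d) := by
  have hz : ∀ v ∉ Submodule.span k {SchurSuper.canonicalElement k m n lam hd hlam},
      ∃ x ∈ SchurSuper.upperN k m n d, x • v = SchurSuper.canonicalElement k m n lam hd hlam :=
    fun _ hv => SchurSuper.exists_smul_eq_canonicalElement hk hv
  have hz0 : SchurSuper.canonicalElement k m n lam hd hlam ≠ 0 :=
    SchurSuper.canonicalElement_ne_zero hk
  exact ⟨fun _ hW hW0 => SchurSuper.mem_of_isNSubmodule_of_ne_bot hz hW hW0,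
    SchurSuper.nInvariants_eq_span_singleton hz hz0
      fun _ hx => SchurSuper.smul_canonicalElement_eq_zero hk hx,
    SchurSuper.isNIndecomposable_of_forall_mem hz0
      fun _ hW hW0 => SchurSuper.mem_of_isNSubmodule_of_ne_bot hz hW hW0⟩
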